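/- Let $q,s\in\mathbb{C}$ with $|q|<1$, $|s|<1$, and write $(a;q)_k=\prod_{i=1}^{k}(1-aq^{i-1})$, $(a;q)_\infty=\prod_{i\ge 1}(1-aq^{i-1})$. For $x\in\mathbb{C}$ and $i,j,k,\ell\in\mathbb{Z}_{\ge 0}$ define the vertex weight $$W_x(i,j;k,\ell)=\mathbf 1_{i+j=k+\ell}\,\mathbf 1_{i\ge \ell}\; x^{\ell}\,\frac{(-s/x;q)_\ell\,(-sx;q)_{i-\ell}\,(q;q)_k}{(q;q)_\ell\,(q;q)_{i-\ell}\,(s^2;q)_k}$$ of a vertex with bottom, left, top and right edge states $i,j,k,\ell$, where $x^\ell(-s/x;q)_\ell$ stands for the polynomial $\prod_{i=1}^{\ell}(x+sq^{i-1})$; also put $$W_x(\infty,0;\infty,\ell)=\lim_{i\to\infty}W_x(i,0;i-\ell,\ell)=x^{\ell}\,\frac{(-s/x;q)_\ell\,(-sx;q)_\infty}{(q;q)_\ell\,(s^2;q)_\infty}.$$ For partitions (weakly decreasing sequences of positive integers, extended by zeros) $\lambda,\mu$, with conjugates $\lambda',\mu'$, and $n\ge 1$, consider the lattice with $n$ rows,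 numbered from bottom to top, and columns $0,1,2,\dots$, numbered from left to right. Attach to each edge a non-negative integer (all but finitely many of them zero in columns $1,2,\dots$ and on the horizontal edges), except that all vertical edges of column $0$ have state $\infty$. The leftmost edge of every row has state $0$; the bottom, respectively top, vertical edge of column $i\ge 1$ has state $m_i(\mu')=\mu_i-\mu_{i+1}$, respectively $m_i(\lambda')=\lambda_i-\lambda_{i+1}$. Let $Z_{\lambda/\mu}(x_1,\dots,x_n)$ be the sum over all such configurations of the product of the vertex weights, where the vertices in row $r$ have weight $W_{x_r}$; only finitely many configurations contribute. For $x_1,\dots,x_n$ in the open unit disc, the skew spin $q$-Whittaker polynomial and its dual are $$\mathbb F_{\lambda/\mu}(x_1,\dots,x_n)=\prod_{i=1}^{n}\frac{(s^2;q)_\infty}{(-sx_i;q)_\infty}\;Z_{\lambda/\mu}(x_1,\dots,x_n),$$ $$\mathbb F^{*}_{\lambda/\mu}(x_1,\dots,x_n)=\prod_{i\ge 1}\frac{(s^2;q)_{\lambda_i-\lambda_{i+1}}}{(q;q)_{\lambda_i-\lambda_{i+1}}}\,\frac{(q;q)_{\mu_i-\mu_{i+1}}}{(s^2;q)_{\mu_i-\mu_{i+1}}}\;\mathbb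 F_{\lambda/\mu}(x_1,\dots,x_n).$$ **Theorem.** Let $m,n\ge 1$, let $\mu,\nu$ be partitions, and let $x_1,\dots,x_m,y_1,\dots,y_n\in\mathbb{C}$ have absolute value less than $1$. Then $$\sum_{\lambda}\mathbb F_{\lambda/\mu}(x_1,\dots,x_m)\,\mathbb F^{*}_{\lambda/\nu}(y_1,\dots,y_n)=\prod_{i=1}^{m}\prod_{j=1}^{n}\frac{(-sx_i;q)_\infty(-sy_j;q)_\infty}{(s^2;q)_\infty(x_iy_j;q)_\infty}\;\sum_{\kappa}\mathbb F_{\nu/\kappa}(x_1,\dots,x_m)\,\mathbb F^{*}_{\mu/\kappa}(y_1,\dots,y_n),$$ where the left-hand sum, which converges absolutely, runs over all partitions $\lambda$ with $\lambda\supset\mu$ and $\lambda\supset\nu$, and the right-hand (finite) sum runs over all partitions $\kappa$ with $\kappa\subset\mu$ and $\kappa\subset\nu$. -/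

import Mathlib

/-! Spin `q`-Whittaker polynomials as partition functions of a lattice model.

Throughout, `q` and `s` are complex parameters, in the unit disc in the theorem.  Columns of the
lattice are numbered `0, 1, 2, …` from left to right.  Column `0` carries infinitely many vertical
paths.  States of the columns `1, 2, …` are finitely supported functions `ℕ →₀ ℕ`, whose value at
`c` is the occupation number of column `c + 1`. -/

namespace SpinQWhittaker

noncomputable section

/-- The finite `q`-Pochhammer symbol `(a; q)_n = (1 - a) (1 - a q) ⋯ (1 - a q ^ (n - 1))`. -/
def qPoch (q a : ℂ) (n : ℕ) : ℂ := ∏ i ∈ Finset.range n, (1 - a * q ^ i)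

/-- The infinite `q`-Pochhammer symbol `(a; q)_∞`; the product converges for `|q| < 1`. -/
def qPochInf (q a : ℂ) : ℂ := ∏' i : ℕ, (1 - a * q ^ i)

/-- The expression `x ^ l * (-s / x; q)_l`, written as the polynomial
`(x + s) (x + s q) ⋯ (x + s q ^ (l - 1))` in `x`, so that it also makes sense at `x = 0`. -/
def numer (q s x : ℂ) (l : ℕ) : ℂ := ∏ i ∈ Finset.range l, (x + s * q ^ i)

theorem numer_eq (q s : ℂ) {x : ℂ} (hx : x ≠ 0) (l : ℕ) :
    numer q s x l = x ^ l * qPoch q (-s / x) l := by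
  rw [numer, qPoch, ← Finset.card_range l, ← Finset.prod_const, Finset.card_range,
    ← Finset.prod_mul_distrib]
  refine Finset.prod_congr rfl fun i _ => ?_
  field_simp
  ring

/-- The weight `W_x(i, j; k, l)` of a vertex with bottom, left, top, right edge states
`i, j, k, l`:
`1_{i + j = k + l} 1_{i ≥ l} x ^ l (-s/x; q)_l (-s x; q)_{i-l} (q; q)_k /
  ((q; q)_l (q; q)_{i-l} (s²; q)_k)`. -/
def vertexWeight (q s x : ℂ) (i j k l : ℕ) : ℂ :=
  if i + j = k + l ∧ l ≤ i then
    numer q s x l * qPoch q (-s * x) (i - l) * qPoch q q k /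
      (qPoch q q l * qPoch q q (i - l) * qPoch q (s ^ 2) k)
  else 0

/-- The weight `W_x(∞, 0; ∞, l)` of a vertex in column `0`, with infinitely many paths on both
vertical edges, no path on the left edge and `l` paths on the right edge:
`x ^ l (-s/x; q)_l (-s x; q)_∞ / ((q; q)_l (s²; q)_∞)`. -/
def vertexWeightInf (q s x : ℂ) (l : ℕ) : ℂ :=
  numer q s x l * qPochInf q (-s * x) / (qPoch q q l * qPochInf q (s ^ 2))

theorem summable_qPoch {q : ℂ} (hq : ‖q‖ < 1) (a : ℂ) :
    Summable fun i : ℕ => ‖-(a * q ^ i)‖ := by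
  simp only [norm_neg, norm_mul, norm_pow]
  exact (summable_geometric_of_lt_one (norm_nonneg _) hq).mul_left _

/-- The infinite `q`-Pochhammer symbol is the limit of the finite ones. -/
theorem tendsto_qPoch {q : ℂ} (hq : ‖q‖ < 1) (a : ℂ) :
    Filter.Tendsto (qPoch q a) Filter.atTop (nhds (qPochInf q a)) := by
  have h := multipliable_one_add_of_summable (summable_qPoch hq a)
  have h2 := h.tendsto_prod_tprod_nat
  simp only [← sub_eq_add_neg] at h2
  exact h2

theorem one_sub_ne_zero_of_norm {q a : ℂ} (hq : ‖q‖ < 1) (ha : ‖a‖ < 1) (i : ℕ) :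
    1 - a * q ^ i ≠ 0 := by
  intro h
  have h1 : a * q ^ i = 1 := (sub_eq_zero.1 h).symm
  have h2 : ‖a‖ * ‖q‖ ^ i = 1 := by rw [← norm_pow, ← norm_mul, h1, norm_one]
  have h3 : ‖a‖ * ‖q‖ ^ i ≤ ‖a‖ * 1 :=
    mul_le_mul_of_nonneg_left (pow_le_one₀ (norm_nonneg _) hq.le) (norm_nonneg _)
  linarith

theorem qPoch_ne_zero {q a : ℂ} (hq : ‖q‖ < 1) (ha : ‖a‖ < 1) (n : ℕ) : qPoch q a n ≠ 0 :=
  Finset.prod_ne_zero_iff.2 fun i _ => one_sub_ne_zero_of_norm hq ha i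

theorem qPochInf_ne_zero {q a : ℂ} (hq : ‖q‖ < 1) (ha : ‖a‖ < 1) : qPochInf q a ≠ 0 := by
  have h := tprod_one_add_ne_zero_of_summable (f := fun i : ℕ => -(a * q ^ i))
    (fun i => by rw [← sub_eq_add_neg]; exact one_sub_ne_zero_of_norm hq ha i)
    (summable_qPoch hq a)
  simp only [← sub_eq_add_neg] at h
  exact h

/-- The weight `W_x(∞, 0; ∞, l)` is the limit of `W_x(i, 0; i - l, l)` as `i → ∞`. -/
theorem tendsto_vertexWeight {q s : ℂ} (hq : ‖q‖ < 1) (hs : ‖s‖ < 1) (x : ℂ) (l : ℕ) :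
    Filter.Tendsto (fun i => vertexWeight q s x i 0 (i - l) l) Filter.atTop
      (nhds (vertexWeightInf q s x l)) := by
  have hs2 : ‖s ^ 2‖ < 1 := by
    rw [norm_pow]
    exact pow_lt_one₀ (norm_nonneg _) hs two_ne_zero
  have h1 := (tendsto_qPoch hq (-s * x)).comp (Filter.tendsto_sub_atTop_nat l)
  have h2 := (tendsto_qPoch hq (s ^ 2)).comp (Filter.tendsto_sub_atTop_nat l)
  have h3 := (h1.const_mul (numer q s x l)).div (h2.const_mul (qPoch q q l))
    (mul_ne_zero (qPoch_ne_zero hq hq l) (qPochInf_ne_zero hq hs2))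
  refine h3.congr' ?_
  filter_upwards [Filter.eventually_ge_atTop l] with i hi
  have hne := qPoch_ne_zero hq hq (i - l)
  have hne2 := qPoch_ne_zero hq hs2 (i - l)
  have hne3 := qPoch_ne_zero hq hq l
  rw [vertexWeight, if_pos ⟨by omega, hi⟩]
  simp only [Pi.div_apply, Function.comp_apply]
  field_simp

/-- The weight of a configuration on the lattice with `n` rows, numbered from bottom to top and
with parameters `x 0, …, x (n - 1)`.  Here `v r` is the state of the vertical edges (of the columns
`1, 2, …`) below row `r`, `v (last n)` is the state of those at the top, and `h r c` is the number
of paths on the edge of row `r` between the columns `c` and `c + 1`.  The left edge of each row is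
empty, and so is the right end, as `h r` is finitely supported. -/
def configWeight (q s : ℂ) {n : ℕ} (x : Fin n → ℂ)
    (v : Fin (n + 1) → ℕ →₀ ℕ) (h : Fin n → ℕ →₀ ℕ) : ℂ :=
  ∏ r : Fin n, (vertexWeightInf q s (x r) (h r 0) *
    ∏ᶠ c : ℕ, vertexWeight q s (x r) (v r.castSucc c) (h r c) (v r.succ c) (h r (c + 1)))

open Classical in
/-- The partition function of the lattice: the sum of the weights of all configurations whose
vertical edges in the columns `1, 2, …` are in the state `bot` at the bottom and in the state `top`
at the top.  Only finitely many configurations contribute, see `finite_support` below. -/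
def partitionFunction (q s : ℂ) {n : ℕ} (x : Fin n → ℂ) (bot top : ℕ →₀ ℕ) : ℂ :=
  ∑ᶠ p : (Fin (n + 1) → ℕ →₀ ℕ) × (Fin n → ℕ →₀ ℕ),
    if p.1 0 = bot ∧ p.1 (Fin.last n) = top then configWeight q s x p.1 p.2 else 0

theorem rowLen_eq_zero (lam : YoungDiagram) {c : ℕ} (hc : lam.colLen 0 ≤ c) :
    lam.rowLen c = 0 := by
  by_contra hne
  have h1 : (c, 0) ∈ lam := YoungDiagram.mem_iff_lt_rowLen.2 (Nat.pos_of_ne_zero hne)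
  have h2 := YoungDiagram.mem_iff_lt_colLen.1 h1
  omega

/-- The state attached to the conjugate `λ'` of a partition `λ`, regarded as a Young diagram:
column `i = c + 1` of the lattice carries `m_i(λ') = λ_i - λ_{i+1}` paths
(where `λ_i = lam.rowLen (i - 1)`). -/
def conjState (lam : YoungDiagram) : ℕ →₀ ℕ :=
  Finsupp.onFinset (Finset.range (lam.colLen 0))
    (fun c => lam.rowLen c - lam.rowLen (c + 1)) (by
      intro c hc
      rw [Finset.mem_range]
      by_contra hlt
      exact hc (by rw [rowLen_eq_zero lam (not_lt.1 hlt), Nat.zero_sub]))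

/-- `conjState lam c` is the number of parts of the conjugate partition equal to `c + 1`. -/
theorem conjState_eq_card (lam : YoungDiagram) (c : ℕ) :
    conjState lam c =
      ((Finset.range (lam.rowLen 0)).filter fun j => lam.transpose.rowLen j = c + 1).card := by
  have key : ((Finset.range (lam.rowLen 0)).filter fun j => lam.transpose.rowLen j = c + 1) =
      Finset.Ico (lam.rowLen (c + 1)) (lam.rowLen c) := by
    ext j
    have h0 := lam.rowLen_anti 0 c (Nat.zero_le c)
    have h1 : j < lam.rowLen c ↔ c < lam.colLen j := by
      rw [← YoungDiagram.mem_iff_lt_rowLen, YoungDiagram.mem_iff_lt_colLen]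
    have h2 : j < lam.rowLen (c + 1) ↔ c + 1 < lam.colLen j := by
      rw [← YoungDiagram.mem_iff_lt_rowLen, YoungDiagram.mem_iff_lt_colLen]
    rw [Finset.mem_filter, Finset.mem_range, Finset.mem_Ico, YoungDiagram.rowLen_transpose]
    omega
  rw [key, Nat.card_Ico]
  rfl

/-- The skew spin `q`-Whittaker polynomial `F_{λ/μ}(x_1, …, x_n)`: the partition function with the
bottom state attached to `μ'` and the top state attached to `λ'`, divided by
`∏ (-s x_i; q)_∞ / (s²; q)_∞`. -/
def spinWhittaker (q s : ℂ) {n : ℕ} (lam mu : YoungDiagram) (x : Fin n → ℂ) : ℂ :=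
  partitionFunction q s x (conjState mu) (conjState lam) /
    ∏ i : Fin n, (qPochInf q (-s * x i) / qPochInf q (s ^ 2))

/-- The constant `∏_{i ≥ 1} (s²; q)_{λ_i - λ_{i+1}} / (q; q)_{λ_i - λ_{i+1}}`; the factors beyond
the last nonzero part of `λ` equal `1`. -/
def dualFactor (q s : ℂ) (lam : YoungDiagram) : ℂ :=
  ∏ i ∈ Finset.range (lam.colLen 0),
    qPoch q (s ^ 2) (lam.rowLen i - lam.rowLen (i + 1)) /
      qPoch q q (lam.rowLen i - lam.rowLen (i + 1))

/-- The dual skew spin `q`-Whittaker polynomial `F*_{λ/μ}(x_1, …, x_n)`. -/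
def dualSpinWhittaker (q s : ℂ) {n : ℕ} (lam mu : YoungDiagram) (x : Fin n → ℂ) : ℂ :=
  dualFactor q s lam / dualFactor q s mu * spinWhittaker q s lam mu x

instance finite_subdiagrams (mu nu : YoungDiagram) :
    Finite {kap : YoungDiagram // kap ≤ mu ∧ kap ≤ nu} :=
  Finite.of_injective
    (fun kap => (⟨kap.1.cells, Finset.mem_powerset.2 (YoungDiagram.cells_subset_iff.2 kap.2.1)⟩ :
      {t : Finset (ℕ × ℕ) // t ∈ mu.cells.powerset}))
    (fun _ _ hab => Subtype.ext (YoungDiagram.ext (congrArg Subtype.val hab)))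

instance fintypeSubdiagrams (mu nu : YoungDiagram) :
    Fintype {kap : YoungDiagram // kap ≤ mu ∧ kap ≤ nu} :=
  Fintype.ofFinite _

/-! ### The partition function is well defined -/

theorem qPoch_zero (q a : ℂ) : qPoch q a 0 = 1 := by simp [qPoch]

theorem vertexWeight_zero (q s x : ℂ) : vertexWeight q s x 0 0 0 0 = 1 := by
  simp [vertexWeight, numer, qPoch]

theorem exists_eq_zero (f : ℕ →₀ ℕ) : ∃ N, ∀ c, N ≤ c → f c = 0 := by
  refine ⟨f.support.sup id + 1, fun c hc => ?_⟩
  by_contra hne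
  have : c ≤ f.support.sup id := Finset.le_sup (f := id) (Finsupp.mem_support_iff.2 hne)
  omega

/-- In each row all but finitely many vertices have weight one. -/
theorem finite_mulSupport (q s x : ℂ) (b h t : ℕ →₀ ℕ) :
    (Function.mulSupport fun c : ℕ => vertexWeight q s x (b c) (h c) (t c) (h (c + 1))).Finite := by
  obtain ⟨N1, h1⟩ := exists_eq_zero b
  obtain ⟨N2, h2⟩ := exists_eq_zero h
  obtain ⟨N3, h3⟩ := exists_eq_zero t
  refine (Finset.finite_toSet (Finset.range (N1 + N2 + N3))).subset fun c hc => ?_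
  rw [Finset.mem_coe, Finset.mem_range]
  by_contra hlt
  refine hc ?_
  change vertexWeight q s x (b c) (h c) (t c) (h (c + 1)) = 1
  rw [h1 c (by omega), h2 c (by omega), h3 c (by omega), h2 (c + 1) (by omega),
    vertexWeight_zero]

/-- Number of paths in the columns with index at least `c`. -/
def tailSum (f : ℕ →₀ ℕ) (c : ℕ) : ℕ := f.sum fun i a => if c ≤ i then a else 0

theorem tailSum_succ (f : ℕ →₀ ℕ) (c : ℕ) : tailSum f c = f c + tailSum f (c + 1) := by
  have h1 : f c = f.sum fun i a => if i = c then a else 0 := by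
    rw [Finsupp.sum_ite_eq']
    by_cases hc : c ∈ f.support
    · rw [if_pos hc]
    · rw [if_neg hc, Finsupp.notMem_support_iff.1 hc]
  rw [h1, tailSum, tailSum, ← Finsupp.sum_add]
  refine Finsupp.sum_congr fun i _ => ?_
  split_ifs <;> omega

theorem exists_tailSum_eq_zero (f : ℕ →₀ ℕ) : ∃ N, ∀ c, N ≤ c → tailSum f c = 0 := by
  refine ⟨f.support.sup id + 1, fun c hc => ?_⟩
  refine Finset.sum_eq_zero fun i hi => if_neg ?_
  have : i ≤ f.support.sup id := Finset.le_sup (f := id) hi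
  omega

theorem tailSum_conservation (b h t : ℕ →₀ ℕ)
    (hc : ∀ c, b c + h c = t c + h (c + 1)) (c : ℕ) : tailSum b c + h c = tailSum t c := by
  obtain ⟨N1, h1⟩ := exists_tailSum_eq_zero b
  obtain ⟨N2, h2⟩ := exists_tailSum_eq_zero t
  obtain ⟨N3, h3⟩ := exists_tailSum_eq_zero h
  have aux : ∀ k c, N1 + N2 + N3 ≤ c + k → tailSum b c + h c = tailSum t c := by
    intro k
    induction k with
    | zero =>
      intro c hle
      have e3 := h3 c (by omega)
      rw [tailSum_succ] at e3
      rw [h1 c (by omega), h2 c (by omega)]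
      omega
    | succ k ih =>
      intro c hle
      have := ih (c + 1) (by omega)
      rw [tailSum_succ b, tailSum_succ t]
      have := hc c
      omega
  exact aux (N1 + N2 + N3) c (by omega)

/-- Only finitely many configurations with given boundary states have nonzero weight. -/
theorem finite_support (q s : ℂ) {n : ℕ} (x : Fin n → ℂ) (top : ℕ →₀ ℕ) :
    {p : (Fin (n + 1) → ℕ →₀ ℕ) × (Fin n → ℕ →₀ ℕ) |
      p.1 (Fin.last n) = top ∧ configWeight q s x p.1 p.2 ≠ 0}.Finite := by
  classical
  obtain ⟨N, hN⟩ := exists_tailSum_eq_zero top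
  let g : ℕ →₀ ℕ := Finsupp.onFinset (Finset.range N) (tailSum top) (by
    intro c hc
    rw [Finset.mem_range]
    by_contra hlt
    exact hc (hN c (not_lt.1 hlt)))
  refine ((Set.finite_Icc (0 : Fin (n + 1) → ℕ →₀ ℕ) (fun _ => g)).prod
    (Set.finite_Icc (0 : Fin n → ℕ →₀ ℕ) (fun _ => g))).subset ?_
  rintro ⟨v, h⟩ ⟨htop, hw⟩
  have hcons : ∀ r c, v r.castSucc c + h r c = v r.succ c + h r (c + 1) := by
    intro r c
    by_contra hne
    apply hw
    refine Finset.prod_eq_zero (Finset.mem_univ r) (mul_eq_zero_of_right _ ?_)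
    refine finprod_eq_zero _ c (if_neg fun hh => hne hh.1) (finite_mulSupport q s (x r) _ _ _)
  have hrow := fun r => tailSum_conservation _ _ _ (hcons r)
  have hv : ∀ r c, tailSum (v r) c ≤ tailSum top c := by
    intro r
    induction r using Fin.reverseInduction with
    | last => intro c; exact le_of_eq (by rw [← htop])
    | cast r ih =>
      intro c
      have h1 := hrow r c
      have h2 := ih c
      omega
  refine ⟨⟨fun _ _ => Nat.zero_le _, fun r c => ?_⟩, fun _ _ => Nat.zero_le _, fun r c => ?_⟩
  · have h1 := hv r c
    rw [tailSum_succ] at h1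
    exact le_trans (Nat.le_add_right _ _) h1
  · have h1 := hrow r c
    have h2 := hv r.succ c
    exact le_trans (by omega : h r c ≤ tailSum (v r.succ) c) h2

end

end SpinQWhittaker

/-! Why the skew Cauchy identity holds.

A row of the lattice is regarded as a kernel on the states of the vertical edges, that is, on
partitions (`stateEquiv`).  Since column `0` carries infinitely many paths and paths are conserved,
the horizontal edges are determined by the two states, and the lattice with several rows is the
composition of the kernels of its rows (`partitionFunction_eq_tsum`, `tsum_pathWeight`).  The
identity is a commutation relation of such kernels, `SkewCauchy`, which is preserved by composition
(`SkewCauchy.comp`).  This reduces the theorem to one variable `x` and one variable `y`.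

For one variable, the row of parameter `q * x` factors as a strip row, with at most one path on each
horizontal edge, followed by the row of parameter `x` (`tsum_stripRow_mul_whittakerRow`).  The strip
row is exchanged with the dual row of parameter `y` by means of a Yang–Baxter relation: a cross
vertex is moved through the two rows column by column (`exchange_zero`, `exchange_one`,
`pairAbove_eq`, `stripRow_dualRow_exchange`).  At `x = -s` all weights that move paths to the right
vanish, so that the row is the identity kernel (`whittakerRow_neg`) and the skew Cauchy identity is
trivial.  Adding strip rows one after another proves it for all `x = -s * q ^ J`
(`skewCauchy_special`).

These points accumulate at `0`, and both sides are holomorphic in `x` in the unit disc, as the sum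
on the left converges locally uniformly (`exists_summable_bound`).  Hence the identity holds for all
`x` as long as `q` and `s` are nonzero (`cauchyDefect_of_ne_zero`).  Both sides are holomorphic in
`q` and `s` as well, which gives the remaining cases (`cauchyDefect_eq_zero`). -/

namespace SpinQWhittaker

noncomputable section

/-! ### States -/

/-- The state with value `n` in the first column, followed by the state `f`. -/
def consState (n : ℕ) (f : ℕ →₀ ℕ) : ℕ →₀ ℕ :=
  Finsupp.single 0 n + f.mapDomain Nat.succ

/-- The state obtained by deleting the first column. -/
def tailState (f : ℕ →₀ ℕ) : ℕ →₀ ℕ :=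
  f.comapDomain Nat.succ Nat.succ_injective.injOn

@[simp] theorem consState_zero (n : ℕ) (f : ℕ →₀ ℕ) : consState n f 0 = n := by
  rw [consState, Finsupp.add_apply, Finsupp.single_eq_same,
    Finsupp.mapDomain_of_notMem_range _ _ (by simp), add_zero]

@[simp] theorem consState_succ (n : ℕ) (f : ℕ →₀ ℕ) (c : ℕ) : consState n f (c + 1) = f c := by
  rw [consState, Finsupp.add_apply, Finsupp.single_eq_of_ne (by simp), zero_add,
    ← Nat.succ_eq_add_one, Finsupp.mapDomain_apply Nat.succ_injective]

@[simp] theorem tailState_apply (f : ℕ →₀ ℕ) (c : ℕ) : tailState f c = f (c + 1) := rfl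

/-- Splitting off the first column of a state. -/
def consEquiv : ℕ × (ℕ →₀ ℕ) ≃ (ℕ →₀ ℕ) where
  toFun p := consState p.1 p.2
  invFun f := (f 0, tailState f)
  left_inv p := by
    refine Prod.ext (by simp) (Finsupp.ext fun c => by simp)
  right_inv f := by
    ext c
    cases c <;> simp

theorem consState_zero_zero : consState 0 0 = 0 := by
  ext c
  cases c <;> simp

theorem consState_surj (f : ℕ →₀ ℕ) : f = consState (f 0) (tailState f) :=
  (consEquiv.right_inv f).symm

/-- Two states can be built simultaneously from the empty ones by adding columns in front. -/
theorem state_induction₂ {P : (ℕ →₀ ℕ) → (ℕ →₀ ℕ) → Prop} (h0 : P 0 0)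
    (hc : ∀ m n f g, P f g → P (consState m f) (consState n g)) (f g : ℕ →₀ ℕ) : P f g := by
  obtain ⟨N1, h1⟩ := exists_eq_zero f
  obtain ⟨N2, h2⟩ := exists_eq_zero g
  have aux : ∀ N (f g : ℕ →₀ ℕ), (∀ c, N ≤ c → f c = 0) → (∀ c, N ≤ c → g c = 0) → P f g := by
    intro N
    induction N with
    | zero =>
      intro f g hf hg
      have e1 : f = 0 := Finsupp.ext fun c => hf c (Nat.zero_le _)
      have e2 : g = 0 := Finsupp.ext fun c => hg c (Nat.zero_le _)
      rw [e1, e2]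
      exact h0
    | succ N ih =>
      intro f g hf hg
      rw [consState_surj f, consState_surj g]
      exact hc _ _ _ _ (ih _ _ (fun c h => hf _ (by omega)) (fun c h => hg _ (by omega)))
  exact aux (N1 + N2) f g (fun c h => h1 c (by omega)) (fun c h => h2 c (by omega))

theorem tailSum_unique (f : ℕ →₀ ℕ) (F : ℕ → ℕ) (hF : ∀ c, F c = f c + F (c + 1))
    (h0 : ∃ N, ∀ c, N ≤ c → F c = 0) (c : ℕ) : tailSum f c = F c := by
  obtain ⟨N1, h1⟩ := exists_tailSum_eq_zero f
  obtain ⟨N2, h2⟩ := h0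
  have aux : ∀ k c, N1 + N2 ≤ c + k → tailSum f c = F c := by
    intro k
    induction k with
    | zero =>
      intro c hle
      rw [h1 c (by omega), h2 c (by omega)]
    | succ k ih =>
      intro c hle
      rw [tailSum_succ, hF, ih (c + 1) (by omega)]
  exact aux (N1 + N2) c (by omega)

@[simp] theorem tailSum_zero (c : ℕ) : tailSum 0 c = 0 := by simp [tailSum]

@[simp] theorem tailSum_consState_succ (n : ℕ) (f : ℕ →₀ ℕ) (c : ℕ) :
    tailSum (consState n f) (c + 1) = tailSum f c := by
  obtain ⟨N, h⟩ := exists_tailSum_eq_zero (consState n f)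
  refine (tailSum_unique f (fun c => tailSum (consState n f) (c + 1)) (fun c => ?_)
    ⟨N, fun c hc => h _ (by omega)⟩ c).symm
  rw [tailSum_succ, consState_succ]

@[simp] theorem tailSum_consState_zero (n : ℕ) (f : ℕ →₀ ℕ) :
    tailSum (consState n f) 0 = n + tailSum f 0 := by
  rw [tailSum_succ, consState_zero, tailSum_consState_succ]

theorem tailSum_anti (f : ℕ →₀ ℕ) : Antitone (tailSum f) :=
  antitone_nat_of_succ_le fun c => by rw [tailSum_succ f c]; omega

theorem eq_of_tailSum_eq {f g : ℕ →₀ ℕ} (h : ∀ c, tailSum f c = tailSum g c) : f = g := by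
  ext c
  have h1 := h c
  rw [tailSum_succ f, tailSum_succ g, h (c + 1)] at h1
  omega

theorem eq_zero_of_tailSum_zero {f : ℕ →₀ ℕ} (h : tailSum f 0 = 0) : f = 0 :=
  eq_of_tailSum_eq fun c => by
    have := tailSum_anti f (Nat.zero_le c)
    rw [tailSum_zero]
    omega

/-- Containment of Young diagrams, for the corresponding states: `tailSum f c` is the length of the
row `c` of the diagram of `f`. -/
def StateLE (f g : ℕ →₀ ℕ) : Prop := ∀ c, tailSum f c ≤ tailSum g c

theorem StateLE.trans {f g h : ℕ →₀ ℕ} (h1 : StateLE f g) (h2 : StateLE g h) : StateLE f h :=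
  fun c => (h1 c).trans (h2 c)

/-- Finitely many states have tail sums bounded by an eventually vanishing sequence. -/
theorem finite_setOf_tailSum_le {G : ℕ → ℕ} (hG : ∃ N, ∀ c, N ≤ c → G c = 0) :
    {f : ℕ →₀ ℕ | ∀ c, tailSum f c ≤ G c}.Finite := by
  obtain ⟨N, hN⟩ := hG
  let g : ℕ →₀ ℕ := Finsupp.onFinset (Finset.range N) G (by
    intro c hc
    rw [Finset.mem_range]
    by_contra hlt
    exact hc (hN c (not_lt.1 hlt)))
  refine (Set.finite_Icc (0 : ℕ →₀ ℕ) g).subset fun f hf => ⟨fun _ => Nat.zero_le _, fun c => ?_⟩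
  have h1 := hf c
  rw [tailSum_succ] at h1
  exact le_trans (Nat.le_add_right _ _) h1

theorem finite_setOf_stateLE (g : ℕ →₀ ℕ) : {f | StateLE f g}.Finite :=
  finite_setOf_tailSum_le (exists_tailSum_eq_zero g)

/-- Summing over the first column and over the remaining ones. -/
theorem tsum_consState {f : (ℕ →₀ ℕ) → ℂ} (hf : (Function.support f).Finite) :
    ∑' g, f g = ∑' n, ∑' g, f (consState n g) := by
  rw [← consEquiv.tsum_eq f]
  exact ((consEquiv.summable_iff (f := f)).2 (summable_of_hasFiniteSupport hf)).tsum_prod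

/-- A sum with at most two nonzero terms, at `M` and at `M - 1`. -/
theorem tsum_eq_add_pred (f : ℕ → ℂ) (M : ℕ) (h : ∀ l, l ≠ M → l + 1 ≠ M → f l = 0) :
    ∑' l, f l = f M + if 1 ≤ M then f (M - 1) else 0 := by
  cases M with
  | zero => rw [if_neg (by omega), add_zero, tsum_eq_single 0 fun l hl => h l hl (by omega)]
  | succ M =>
    rw [if_pos (by omega), tsum_eq_sum (s := {M + 1, M}), Finset.sum_pair (by omega)]
    · rfl
    · intro l hl
      simp only [Finset.mem_insert, Finset.mem_singleton, not_or] at hl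
      exact h l hl.1 (by omega)

/-! ### Rows -/

/-- A local weight is admissible if the empty vertex has weight one and paths are conserved. -/
structure Admissible (w : ℕ → ℕ → ℕ → ℕ → ℂ) : Prop where
  zero : w 0 0 0 0 = 1
  conserve : ∀ {i j k l}, w i j k l ≠ 0 → i + j = k + l

/-- The weight of the part of a row to the right of column `0`, when `a` paths enter from the
left.  The state of the horizontal edges is determined by conservation of paths: on the left of
column `c + 1` there are `tailSum t c - tailSum b c` of them. -/
def rowWeight (w : ℕ → ℕ → ℕ → ℕ → ℂ) (a : ℕ) (b t : ℕ →₀ ℕ) : ℂ :=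
  if a + tailSum b 0 = tailSum t 0 then
    ∏ᶠ c, w (b c) (tailSum t c - tailSum b c) (t c) (tailSum t (c + 1) - tailSum b (c + 1))
  else 0

theorem finite_mulSupport_row {w : ℕ → ℕ → ℕ → ℕ → ℂ} (hw : w 0 0 0 0 = 1) (b t : ℕ →₀ ℕ) :
    (Function.mulSupport fun c : ℕ =>
      w (b c) (tailSum t c - tailSum b c) (t c) (tailSum t (c + 1) - tailSum b (c + 1))).Finite := by
  obtain ⟨N1, h1⟩ := exists_tailSum_eq_zero b
  obtain ⟨N2, h2⟩ := exists_tailSum_eq_zero t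
  refine (Finset.finite_toSet (Finset.range (N1 + N2))).subset fun c hc => ?_
  rw [Finset.mem_coe, Finset.mem_range]
  by_contra hlt
  refine hc ?_
  have e1 := tailSum_succ b c
  have e2 := tailSum_succ t c
  have e3 := h1 c (by omega)
  have e4 := h2 c (by omega)
  change w (b c) (tailSum t c - tailSum b c) (t c) (tailSum t (c + 1) - tailSum b (c + 1)) = 1
  rw [show b c = 0 by omega, show t c = 0 by omega, show tailSum t c - tailSum b c = 0 by omega,
    show tailSum t (c + 1) - tailSum b (c + 1) = 0 by omega, hw]

theorem rowWeight_eq_zero_of_ne {w : ℕ → ℕ → ℕ → ℕ → ℂ} {a : ℕ} {b t : ℕ →₀ ℕ}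
    (h : a + tailSum b 0 ≠ tailSum t 0) : rowWeight w a b t = 0 := if_neg h

theorem rowWeight_factor_ne_zero {w : ℕ → ℕ → ℕ → ℕ → ℂ} (hw : Admissible w) {a : ℕ}
    {b t : ℕ →₀ ℕ} (h : rowWeight w a b t ≠ 0) (c : ℕ) :
    w (b c) (tailSum t c - tailSum b c) (t c) (tailSum t (c + 1) - tailSum b (c + 1)) ≠ 0 := by
  intro h0
  refine h ?_
  rw [rowWeight]
  split_ifs
  · exact finprod_eq_zero _ c h0 (finite_mulSupport_row hw.zero b t)
  · rfl

theorem rowWeight_total {w : ℕ → ℕ → ℕ → ℕ → ℂ} {a : ℕ}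
    {b t : ℕ →₀ ℕ} (h : rowWeight w a b t ≠ 0) : a + tailSum b 0 = tailSum t 0 := by
  by_contra hne
  exact h (if_neg hne)

theorem stateLE_of_rowWeight_ne_zero {w : ℕ → ℕ → ℕ → ℕ → ℂ} (hw : Admissible w) {a : ℕ}
    {b t : ℕ →₀ ℕ} (h : rowWeight w a b t ≠ 0) : StateLE b t := by
  intro c
  induction c with
  | zero => have := rowWeight_total h; omega
  | succ c ih =>
    have h1 := hw.conserve (rowWeight_factor_ne_zero hw h c)
    have h2 := tailSum_succ b c
    have h3 := tailSum_succ t c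
    omega

theorem rowWeight_zero {w : ℕ → ℕ → ℕ → ℕ → ℂ} (hw : Admissible w) (a : ℕ) :
    rowWeight w a 0 0 = if a = 0 then 1 else 0 := by
  rw [rowWeight]
  simp [hw.zero]

theorem finprod_eq_mul_succ {f : ℕ → ℂ} (hf : (Function.mulSupport f).Finite) :
    ∏ᶠ c, f c = f 0 * ∏ᶠ c, f (c + 1) := by
  obtain ⟨N, hN⟩ := hf.bddAbove
  have h1 : ∀ c, f c ≠ 1 → c ≤ N := fun c hc => hN hc
  rw [finprod_eq_prod_of_mulSupport_subset (s := Finset.range (N + 2)) f,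
    finprod_eq_prod_of_mulSupport_subset (s := Finset.range (N + 1)) (fun c => f (c + 1)),
    Finset.prod_range_succ', mul_comm]
  · intro c hc
    have := h1 _ hc
    simp only [Finset.coe_range, Set.mem_Iio]
    omega
  · intro c hc
    have := h1 _ hc
    simp only [Finset.coe_range, Set.mem_Iio]
    omega

/-- The recursion that peels off the first column of a row. -/
theorem rowWeight_consState {w : ℕ → ℕ → ℕ → ℕ → ℂ} (hw : Admissible w) (a m l : ℕ)
    (b t : ℕ →₀ ℕ) : rowWeight w a (consState m b) (consState l t) =
      if l ≤ m + a then w m a l (m + a - l) * rowWeight w (m + a - l) b t else 0 := by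
  simp only [rowWeight, tailSum_consState_zero]
  by_cases h : a + (m + tailSum b 0) = l + tailSum t 0
  · rw [if_pos h, finprod_eq_mul_succ (finite_mulSupport_row hw.zero _ _)]
    simp only [consState_zero, consState_succ, tailSum_consState_zero, tailSum_consState_succ]
    split_ifs with h1 h2
    · rw [show l + tailSum t 0 - (m + tailSum b 0) = a by omega,
        show tailSum t 0 - tailSum b 0 = m + a - l by omega]
    · omega
    · by_cases hz : w m (l + tailSum t 0 - (m + tailSum b 0)) l (tailSum t (0 + 1 - 1) -
          tailSum b (0 + 1 - 1)) = 0
      · simp only [Nat.add_sub_cancel] at hz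
        rw [hz, zero_mul]
      · have := hw.conserve hz
        simp only [Nat.add_sub_cancel] at this
        omega
  · rw [if_neg h]
    split_ifs with h1 h2
    · omega
    · rw [mul_zero]
    · rfl

theorem finite_support_rowWeight_mul {w w' : ℕ → ℕ → ℕ → ℕ → ℂ} (hw' : Admissible w') (a b : ℕ)
    (m n : ℕ →₀ ℕ) :
    (Function.support fun r => rowWeight w a m r * rowWeight w' b r n).Finite :=
  (finite_setOf_stateLE n).subset fun _ hr =>
    stateLE_of_rowWeight_ne_zero hw' (right_ne_zero_of_mul hr)

/-- The weight of a row whose column `0` has infinitely many vertical paths, where `β a` is the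
weight of the vertex in column `0` emitting `a` paths to the right.  The truncated subtraction does
no harm: `rowWeight` vanishes if `tailSum t 0 < tailSum b 0`. -/
def fullRow (w : ℕ → ℕ → ℕ → ℕ → ℂ) (β : ℕ → ℂ) (b t : ℕ →₀ ℕ) : ℂ :=
  β (tailSum t 0 - tailSum b 0) * rowWeight w (tailSum t 0 - tailSum b 0) b t

theorem stateLE_of_fullRow_ne_zero {w : ℕ → ℕ → ℕ → ℕ → ℂ} (hw : Admissible w) {β : ℕ → ℂ}
    {b t : ℕ →₀ ℕ} (h : fullRow w β b t ≠ 0) : StateLE b t :=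
  stateLE_of_rowWeight_ne_zero hw (right_ne_zero_of_mul h)

/-! ### Local relations -/

theorem qPoch_succ (q a : ℂ) (n : ℕ) : qPoch q a (n + 1) = qPoch q a n * (1 - a * q ^ n) :=
  Finset.prod_range_succ _ _

theorem numer_zero (q s x : ℂ) : numer q s x 0 = 1 := Finset.prod_range_zero _

theorem numer_succ (q s x : ℂ) (l : ℕ) :
    numer q s x (l + 1) = numer q s x l * (x + s * q ^ l) :=
  Finset.prod_range_succ _ _

theorem qPoch_mul_left (q a : ℂ) (n : ℕ) :
    (1 - a) * qPoch q (a * q) n = qPoch q a n * (1 - a * q ^ n) := by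
  rw [← qPoch_succ, qPoch, qPoch, Finset.prod_range_succ', pow_zero, mul_one, mul_comm]
  congr 1
  refine Finset.prod_congr rfl fun i _ => ?_
  ring

theorem numer_mul_left (q s x : ℂ) (l : ℕ) :
    numer q s (q * x) (l + 1) = (q * x + s) * q ^ l * numer q s x l := by
  rw [numer, Finset.prod_range_succ', pow_zero, mul_one, numer, mul_comm, mul_assoc]
  congr 1
  rw [← Finset.card_range l, ← Finset.prod_const, Finset.card_range, ← Finset.prod_mul_distrib]
  refine Finset.prod_congr rfl fun i _ => ?_
  ring

/-- The weights of a row with at most one path on each horizontal edge, the arguments being the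
bottom, left, top and right edge states.  Composition with such a row turns a row of parameter `x`
into one of parameter `q * x`, see `strip_mul_vertexWeight`. -/
def stripWeight (q s x : ℂ) : ℕ → ℕ → ℕ → ℕ → ℂ
  | i, 0, k, 0 => if i = k then (1 + s * x * q ^ i) / (1 + s * x) else 0
  | i, 0, k, 1 => if i = k + 1 then -x * (1 - s ^ 2 * q ^ k) / (1 + s * x) else 0
  | i, 1, k, 0 => if i + 1 = k then (1 - q ^ k) / (1 + s * x) else 0
  | i, 1, k, 1 => if i = k then -(x + s * q ^ i) / (1 + s * x) else 0
  | _, _, _, _ => 0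

/-- The weight of the vertex of column `0` in a row with the weights `stripWeight`. -/
def stripBoundary (x : ℂ) : ℕ → ℂ
  | 0 => 1
  | 1 => -x
  | _ => 0

/-- The value of `dualVertexWeight` on vertices which conserve paths.  It depends only on the bottom
edge state `n` and on the right edge state `l`. -/
def dualFactorWeight (q s y : ℂ) (n l : ℕ) : ℂ :=
  if l ≤ n then
    numer q s y l * qPoch q (-s * y) (n - l) * qPoch q q n /
      (qPoch q q l * qPoch q q (n - l) * qPoch q (s ^ 2) n)
  else 0

/-- The vertex weight `W_y(n, b; k, l)` multiplied by `(s²; q)_k / (q; q)_k` for the top edge and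
divided by `(s²; q)_n / (q; q)_n` for the bottom edge, see `dualVertexWeight_mul`. -/
def dualVertexWeight (q s y : ℂ) (n b k l : ℕ) : ℂ :=
  if n + b = k + l then dualFactorWeight q s y n l else 0

/-- The weight of the vertex of column `0`, divided by that of a vertex emitting no path. -/
def boundaryWeight (q s x : ℂ) (l : ℕ) : ℂ := numer q s x l / qPoch q q l

/-- The cross weights intertwining a strip row of parameter `x` and a dual row of parameter `y`:
the left edges carry `a` and `b` paths, the right ones `e` and `e + b - a`.  The difference of the
two numbers is conserved, as the paths of the dual row are read in the opposite direction. -/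
def crossWeight (q s x y : ℂ) : ℕ → ℕ → ℕ → ℂ
  | 0, b, 0 => (1 + s * x * q ^ b) / (1 + s * x)
  | 0, b, 1 => -x * (y + s * q ^ b) / (1 + s * x)
  | 1, b, 0 => (1 - q ^ b) / (1 + s * x)
  | 1, b, 1 => (q ^ b - x * y) / (1 + s * x)
  | _, _, _ => 0

theorem admissible_stripWeight {q s x : ℂ} (h : 1 + s * x ≠ 0) :
    Admissible (stripWeight q s x) where
  zero := by simp [stripWeight, h]
  conserve {i j k l} hne := by
    revert hne
    rcases j with _ | _ | j <;> rcases l with _ | _ | l <;> simp only [stripWeight] <;>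
      first
      | (split_ifs with h1
         · intro _; omega
         · intro h2; exact absurd rfl h2)
      | (intro h2; exact absurd rfl h2)

theorem stripWeight_le_one {q s x : ℂ} {i j k l : ℕ} (h : stripWeight q s x i j k l ≠ 0) :
    j ≤ 1 ∧ l ≤ 1 := by
  revert h
  rcases j with _ | _ | j <;> rcases l with _ | _ | l <;> simp [stripWeight]

theorem admissible_vertexWeight (q s x : ℂ) : Admissible (vertexWeight q s x) where
  zero := vertexWeight_zero q s x
  conserve {i j k l} hne := by
    by_contra h
    exact hne (if_neg fun h2 => h h2.1)

theorem admissible_dualVertexWeight (q s y : ℂ) : Admissible (dualVertexWeight q s y) where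
  zero := by simp [dualVertexWeight, dualFactorWeight, numer, qPoch]
  conserve {i j k l} hne := by
    by_contra h
    exact hne (if_neg h)

theorem dualVertexWeight_le {q s y : ℂ} {n b k l : ℕ} (h : dualVertexWeight q s y n b k l ≠ 0) :
    l ≤ n := by
  by_contra h2
  refine h ?_
  rw [dualVertexWeight, dualFactorWeight, if_neg h2, ite_self]

/-- The parameters for which no denominator of a vertex weight vanishes. -/
structure Regular (q s : ℂ) : Prop where
  q_ne : ∀ n, qPoch q q n ≠ 0
  s_ne : ∀ n, qPoch q (s ^ 2) n ≠ 0

theorem norm_sq_lt_one {s : ℂ} (hs : ‖s‖ < 1) : ‖s ^ 2‖ < 1 := by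
  rw [norm_pow]
  exact pow_lt_one₀ (norm_nonneg _) hs two_ne_zero

theorem regular_of_norm_lt_one {q s : ℂ} (hq : ‖q‖ < 1) (hs : ‖s‖ < 1) : Regular q s where
  q_ne := qPoch_ne_zero hq hq
  s_ne := qPoch_ne_zero hq (norm_sq_lt_one hs)

theorem Regular.q_pow {q s : ℂ} (h : Regular q s) (n : ℕ) : 1 - q * q ^ n ≠ 0 := by
  have := h.q_ne (n + 1)
  rw [qPoch_succ] at this
  exact right_ne_zero_of_mul this

theorem Regular.s_pow {q s : ℂ} (h : Regular q s) (n : ℕ) : 1 - s ^ 2 * q ^ n ≠ 0 := by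
  have := h.s_ne (n + 1)
  rw [qPoch_succ] at this
  exact right_ne_zero_of_mul this

theorem dualFactorWeight_of_lt (q s y : ℂ) {n l : ℕ} (h : n < l) :
    dualFactorWeight q s y n l = 0 := if_neg (by omega)

theorem dualFactorWeight_add (q s y : ℂ) (p l : ℕ) :
    dualFactorWeight q s y (l + p) l = numer q s y l * qPoch q (-s * y) p * qPoch q q (l + p) /
      (qPoch q q l * qPoch q q p * qPoch q (s ^ 2) (l + p)) := by
  rw [dualFactorWeight, if_pos (by omega), Nat.add_sub_cancel_left]

theorem dualFactorWeight_succ {q s : ℂ} (h : Regular q s) (y : ℂ) (p l : ℕ) :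
    dualFactorWeight q s y (l + p + 1) l =
      dualFactorWeight q s y (l + p) l * ((1 + s * y * q ^ p) * (1 - q * q ^ (l + p)) /
        ((1 - q * q ^ p) * (1 - s ^ 2 * q ^ (l + p)))) := by
  have h1 := h.q_ne l
  have h2 := h.q_ne p
  have h3 := h.s_ne (l + p)
  have h4 := h.q_pow p
  have h5 := h.s_pow (l + p)
  rw [add_assoc, dualFactorWeight_add, dualFactorWeight_add, ← add_assoc, qPoch_succ, qPoch_succ,
    qPoch_succ, qPoch_succ]
  field_simp
  ring

theorem dualFactorWeight_succ_succ {q s : ℂ} (h : Regular q s) (y : ℂ) (n l : ℕ) :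
    dualFactorWeight q s y (n + 1) (l + 1) =
      dualFactorWeight q s y n l * ((y + s * q ^ l) * (1 - q * q ^ n) /
        ((1 - q * q ^ l) * (1 - s ^ 2 * q ^ n))) := by
  rcases lt_or_ge n l with hlt | hge
  · rw [dualFactorWeight_of_lt _ _ _ hlt, dualFactorWeight_of_lt _ _ _ (by omega), zero_mul]
  obtain ⟨p, rfl⟩ := Nat.exists_eq_add_of_le hge
  have h1 := h.q_ne l
  have h2 := h.q_ne p
  have h3 := h.s_ne (l + p)
  have h4 := h.q_pow l
  have h5 := h.s_pow (l + p)
  rw [show l + p + 1 = l + 1 + p by omega, dualFactorWeight_add, dualFactorWeight_add,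
    show l + 1 + p = l + p + 1 by omega, numer_succ, qPoch_succ, qPoch_succ, qPoch_succ]
  field_simp

/-- Yang–Baxter relation for one column, in the case that on the far right, behind the two vertices
and the cross, the strip row carries no path.  Here `a` and `b` paths enter from the left, `m` and
`n` are the vertical states, and `d` paths of the dual row leave to the right. -/
theorem exchange_zero {q s : ℂ} (h : Regular q s) (x y : ℂ) {m n b d : ℕ} (a : ℕ) (ha : a ≤ 1)
    (hc : n + b = m + a + d) :
    stripWeight q s x m a (m + a) 0 * dualFactorWeight q s y n d * crossWeight q s x y 0 d 0 +
      (if 1 ≤ m + a then stripWeight q s x m a (m + a - 1) 1 * dualFactorWeight q s y n (d + 1) *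
        crossWeight q s x y 1 (d + 1) 0 else 0) =
    crossWeight q s x y a b 0 * (stripWeight q s x n 0 n 0 * dualFactorWeight q s y n d) +
      crossWeight q s x y a b 1 * (if 1 ≤ n then
        stripWeight q s x (n - 1) 1 n 0 * dualFactorWeight q s y (n - 1) d else 0) := by
  rcases lt_trichotomy n d with hlt | rfl | hgt
  · simp [dualFactorWeight_of_lt _ _ _ hlt, dualFactorWeight_of_lt q s y (show n < d + 1 by omega),
      dualFactorWeight_of_lt q s y (show n - 1 < d by omega)]
  · have e1 : (if 1 ≤ n then
        stripWeight q s x (n - 1) 1 n 0 * dualFactorWeight q s y (n - 1) n else 0) = 0 := by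
      split_ifs
      · rw [dualFactorWeight_of_lt _ _ _ (by omega), mul_zero]
      · rfl
    rw [e1, dualFactorWeight_of_lt _ _ _ (Nat.lt_succ_self n)]
    obtain rfl : b = m + a := by omega
    interval_cases a <;> simp [stripWeight, crossWeight] <;> ring
  · obtain ⟨p, rfl⟩ := Nat.exists_eq_add_of_le (show d + 1 ≤ n by omega)
    have h1 := h.q_pow p
    have h2 := h.q_pow d
    have h3 := h.s_pow (d + p)
    rw [show d + 1 + p = d + p + 1 by omega, dualFactorWeight_succ_succ h, dualFactorWeight_succ h,
      if_pos (show 1 ≤ d + p + 1 by omega), Nat.add_sub_cancel]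
    generalize dualFactorWeight q s y (d + p) d = V
    interval_cases a
    · obtain rfl : m = b + p + 1 := by omega
      simp only [stripWeight, crossWeight, add_zero, if_true, Nat.add_sub_cancel,
        Nat.le_add_left]
      by_cases hx : 1 + s * x = 0
      · simp [hx]
      simp only [pow_add, pow_one] at h3 ⊢
      -- The denominators are kept as atoms while they are cleared.
      generalize hu : 1 - q * q ^ p = u at h1 ⊢
      generalize hv : 1 - q * q ^ d = v at h2 ⊢
      generalize hw : 1 - s ^ 2 * (q ^ d * q ^ p) = w at h3 ⊢
      field_simp
      subst hu hv hw
      ring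
    · obtain rfl : m = b + p := by omega
      simp only [stripWeight, crossWeight, if_true, Nat.add_sub_cancel, Nat.le_add_left]
      by_cases hx : 1 + s * x = 0
      · simp [hx]
      simp only [pow_add, pow_one] at h3 ⊢
      generalize hu : 1 - q * q ^ p = u at h1 ⊢
      generalize hv : 1 - q * q ^ d = v at h2 ⊢
      generalize hw : 1 - s ^ 2 * (q ^ d * q ^ p) = w at h3 ⊢
      field_simp
      subst hu hv hw
      ring

/-- Yang–Baxter relation for one column, in the case that on the far right the strip row carries a
path. -/
theorem exchange_one {q s : ℂ} (h : Regular q s) (x y : ℂ) {m n b d : ℕ} (a : ℕ) (ha : a ≤ 1)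
    (hc : n + b + 1 = m + a + d) :
    (if 1 ≤ d then stripWeight q s x m a (m + a) 0 * dualFactorWeight q s y n (d - 1) *
        crossWeight q s x y 0 (d - 1) 1 else 0) +
      (if 1 ≤ m + a then stripWeight q s x m a (m + a - 1) 1 * dualFactorWeight q s y n d *
        crossWeight q s x y 1 d 1 else 0) =
    crossWeight q s x y a b 0 * (stripWeight q s x (n + 1) 0 n 1 *
        dualFactorWeight q s y (n + 1) d) +
      crossWeight q s x y a b 1 * (stripWeight q s x n 1 n 1 * dualFactorWeight q s y n d) := by
  have hx0 : 1 + s * x = 0 ∨ 1 + s * x ≠ 0 := em _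
  rcases d with _ | d
  · have h1 := h.q_pow n
    have h3 := h.s_pow n
    have e1 := dualFactorWeight_succ h y n 0
    rw [zero_add] at e1
    rw [e1, if_neg (show ¬1 ≤ 0 by omega), zero_add]
    generalize dualFactorWeight q s y n 0 = V
    interval_cases a
    · obtain rfl : m = n + b + 1 := by omega
      rcases hx0 with hx | hx
      · simp [hx, stripWeight, crossWeight]
      simp only [stripWeight, crossWeight, add_zero, if_true, Nat.add_sub_cancel, Nat.le_add_left,
        pow_add, pow_zero]
      generalize hu : 1 - q * q ^ n = u at h1 ⊢
      generalize hw : 1 - s ^ 2 * q ^ n = w at h3 ⊢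
      field_simp
      subst hu hw
      ring
    · obtain rfl : m = n + b := by omega
      rcases hx0 with hx | hx
      · simp [hx, stripWeight, crossWeight]
      simp only [stripWeight, crossWeight, if_true, Nat.add_sub_cancel, Nat.le_add_left,
        pow_add, pow_zero]
      generalize hu : 1 - q * q ^ n = u at h1 ⊢
      generalize hw : 1 - s ^ 2 * q ^ n = w at h3 ⊢
      field_simp
      subst hu hw
      ring
  · rw [if_pos (show 1 ≤ d + 1 by omega), Nat.add_sub_cancel, dualFactorWeight_succ_succ h]
    have h2 := h.q_pow d
    rcases lt_trichotomy n d with hlt | rfl | hgt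
    · simp [dualFactorWeight_of_lt _ _ _ hlt,
        dualFactorWeight_of_lt q s y (show n < d + 1 by omega)]
    · rw [dualFactorWeight_of_lt _ _ _ (Nat.lt_succ_self n)]
      have h3 := h.s_pow n
      generalize dualFactorWeight q s y n n = V
      rcases hx0 with hx | hx
      · interval_cases a <;> simp [hx, stripWeight, crossWeight]
      obtain rfl : b = m + a := by omega
      interval_cases a <;>
      · simp only [stripWeight, crossWeight, if_true, mul_zero, zero_mul, ite_self, add_zero,
          pow_add, pow_one]
        generalize hu : 1 - q * q ^ n = u at h2 ⊢
        generalize hw : 1 - s ^ 2 * q ^ n = w at h3 ⊢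
        field_simp
        try subst hu hw
        try ring
    · obtain ⟨p, rfl⟩ := Nat.exists_eq_add_of_le (show d + 1 ≤ n by omega)
      have h1 := h.q_pow p
      have h3 := h.s_pow (d + p)
      have h4 := h.s_pow (d + p + 1)
      rw [show d + 1 + p = d + p + 1 by omega, dualFactorWeight_succ_succ h,
        dualFactorWeight_succ h]
      generalize dualFactorWeight q s y (d + p) d = V
      rcases hx0 with hx | hx
      · interval_cases a <;> simp [hx, stripWeight, crossWeight]
      interval_cases a
      · obtain rfl : m = b + p + 1 := by omega
        simp only [stripWeight, crossWeight, add_zero, if_true, Nat.add_sub_cancel,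
          Nat.le_add_left]
        simp only [pow_add, pow_one] at h3 h4 ⊢
        generalize hu : 1 - q * q ^ p = u at h1 ⊢
        generalize hv : 1 - q * q ^ d = v at h2 ⊢
        generalize hw : 1 - s ^ 2 * (q ^ d * q ^ p) = w at h3 ⊢
        generalize hw' : 1 - s ^ 2 * (q ^ d * q ^ p * q) = w' at h4 ⊢
        field_simp
        subst hu hv hw hw'
        ring
      · obtain rfl : m = b + p := by omega
        simp only [stripWeight, crossWeight, if_true, Nat.add_sub_cancel, Nat.le_add_left]
        simp only [pow_add, pow_one] at h3 h4 ⊢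
        generalize hu : 1 - q * q ^ p = u at h1 ⊢
        generalize hv : 1 - q * q ^ d = v at h2 ⊢
        generalize hw : 1 - s ^ 2 * (q ^ d * q ^ p) = w at h3 ⊢
        generalize hw' : 1 - s ^ 2 * (q ^ d * q ^ p * q) = w' at h4 ⊢
        field_simp
        subst hu hv hw hw'
        ring

/-! ### Moving the cross through a pair of rows -/

/-- If no vertex emits more paths to the right than it receives from below, then the states below
and above the row interlace. -/
theorem interlacing_of_rowWeight_ne_zero {w : ℕ → ℕ → ℕ → ℕ → ℂ} (hw : Admissible w)
    (hn : ∀ {i j k l}, w i j k l ≠ 0 → l ≤ i) {a : ℕ} {b t : ℕ →₀ ℕ}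
    (h : rowWeight w a b t ≠ 0) (c : ℕ) : tailSum t (c + 1) ≤ tailSum b c := by
  have h1 := hn (rowWeight_factor_ne_zero hw h c)
  have h2 := tailSum_succ b c
  omega

/-- A strip row from `m` up to `r` and above it a dual row turned upside down, from `r` back to `n`,
summed over `r`.  The two rows are entered by `a` and `b` paths. -/
def pairAbove (q s x y : ℂ) (a b : ℕ) (m n : ℕ →₀ ℕ) : ℂ :=
  ∑' r, rowWeight (stripWeight q s x) a m r * rowWeight (dualVertexWeight q s y) b n r

/-- A dual row turned upside down, from `m` back to `r`, and above it a strip row from `r` up to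
`n`, summed over `r`.  The strip row is entered by `e` paths and the dual row by `d` paths. -/
def pairBelow (q s x y : ℂ) (e d : ℕ) (m n : ℕ →₀ ℕ) : ℂ :=
  ∑' r, rowWeight (stripWeight q s x) e r n * rowWeight (dualVertexWeight q s y) d r m

/-- The intermediate state is bounded because it interlaces with `n`, except in the first column,
where the number of incoming paths bounds it. -/
theorem finite_support_pairAbove {w w' : ℕ → ℕ → ℕ → ℕ → ℂ}
    (hw' : Admissible w') (hn : ∀ {i j k l}, w' i j k l ≠ 0 → l ≤ i) (a b : ℕ) (m n : ℕ →₀ ℕ) :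
    (Function.support fun r => rowWeight w a m r * rowWeight w' b n r).Finite := by
  obtain ⟨N, hN⟩ := exists_tailSum_eq_zero n
  refine (finite_setOf_tailSum_le (G := fun c => if c = 0 then a + tailSum m 0 else
    tailSum n (c - 1)) ⟨N + 1, fun c hc => ?_⟩).subset fun r hr c => ?_
  · rw [if_neg (by omega)]
    exact hN _ (by omega)
  · rcases c with _ | c
    · exact (rowWeight_total (left_ne_zero_of_mul hr)).ge
    · exact interlacing_of_rowWeight_ne_zero hw' hn (right_ne_zero_of_mul hr) c

theorem stripWeight_of_two_le {q s x : ℂ} {i j k l : ℕ} (h : 2 ≤ l) :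
    stripWeight q s x i j k l = 0 := by
  by_contra h2
  have := (stripWeight_le_one h2).2
  omega

/-- The first column of the pair: the strip row emits no path or one path to the right. -/
theorem pairAbove_consState {q s x : ℂ} (hx : 1 + s * x ≠ 0) (y : ℂ) (a b m n : ℕ)
    (μ ν : ℕ →₀ ℕ) : pairAbove q s x y a b (consState m μ) (consState n ν) =
      (if m + a ≤ n + b then stripWeight q s x m a (m + a) 0 *
        dualFactorWeight q s y n (n + b - (m + a)) *
          pairAbove q s x y 0 (n + b - (m + a)) μ ν else 0) +
      (if 1 ≤ m + a ∧ m + a ≤ n + b + 1 then stripWeight q s x m a (m + a - 1) 1 *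
        dualFactorWeight q s y n (n + b + 1 - (m + a)) *
          pairAbove q s x y 1 (n + b + 1 - (m + a)) μ ν else 0) := by
  have hd := admissible_dualVertexWeight q s y
  have hs := admissible_stripWeight (q := q) hx
  rw [pairAbove, tsum_consState
    (finite_support_pairAbove hd (fun h => dualVertexWeight_le h) _ _ _ _)]
  simp only [rowWeight_consState hs, rowWeight_consState hd]
  rw [tsum_eq_add_pred _ (m + a)]
  · congr 1
    · by_cases h1 : m + a ≤ n + b
      · rw [if_pos h1, pairAbove, ← tsum_mul_left]
        refine tsum_congr fun r => ?_
        rw [if_pos le_rfl, if_pos h1, dualVertexWeight, if_pos (by omega), Nat.sub_self]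
        ring
      · simp [h1]
    · by_cases h1 : 1 ≤ m + a
      · rw [if_pos h1]
        by_cases h2 : m + a ≤ n + b + 1
        · rw [if_pos ⟨h1, h2⟩, pairAbove, ← tsum_mul_left]
          refine tsum_congr fun r => ?_
          rw [if_pos (by omega), if_pos (by omega), dualVertexWeight, if_pos (by omega),
            show m + a - (m + a - 1) = 1 by omega,
            show n + b - (m + a - 1) = n + b + 1 - (m + a) by omega]
          ring
        · rw [if_neg (fun h => h2 h.2)]
          refine (tsum_congr fun r => ?_).trans tsum_zero
          rw [if_neg (show ¬m + a - 1 ≤ n + b by omega), mul_zero]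
      · rw [if_neg h1, if_neg (fun h => h1 h.1)]
  · intro l h1 h2
    refine (tsum_congr fun r => ?_).trans tsum_zero
    by_cases h3 : l ≤ m + a
    · rw [stripWeight_of_two_le (show 2 ≤ m + a - l by omega)]
      simp
    · simp [h3]

theorem pairBelow_consState {q s x : ℂ} (hx : 1 + s * x ≠ 0) (y : ℂ) {e : ℕ} (he : e ≤ 1)
    (d m n : ℕ) (μ ν : ℕ →₀ ℕ) : pairBelow q s x y e d (consState m μ) (consState n ν) =
      (if m ≤ n + 1 - e + d then stripWeight q s x (n + 1 - e) e n 1 *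
        dualFactorWeight q s y (n + 1 - e) (n + 1 - e + d - m) *
          pairBelow q s x y 1 (n + 1 - e + d - m) μ ν else 0) +
      (if e ≤ n ∧ m + e ≤ n + d then stripWeight q s x (n - e) e n 0 *
        dualFactorWeight q s y (n - e) (n - e + d - m) *
          pairBelow q s x y 0 (n - e + d - m) μ ν else 0) := by
  have hd := admissible_dualVertexWeight q s y
  have hs := admissible_stripWeight (q := q) hx
  rw [pairBelow, tsum_consState ((finite_setOf_stateLE (consState m μ)).subset fun _ hr =>
    stateLE_of_rowWeight_ne_zero hd (right_ne_zero_of_mul hr))]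
  simp only [rowWeight_consState hs, rowWeight_consState hd]
  rw [tsum_eq_add_pred _ (n + 1 - e)]
  · congr 1
    · by_cases h1 : m ≤ n + 1 - e + d
      · rw [if_pos h1, pairBelow, ← tsum_mul_left]
        refine tsum_congr fun r => ?_
        rw [if_pos (by omega), if_pos h1, dualVertexWeight, if_pos (by omega),
          show n + 1 - e + e - n = 1 by omega]
        ring
      · simp [h1]
    · by_cases h1 : e ≤ n
      · rw [if_pos (show 1 ≤ n + 1 - e by omega), show n + 1 - e - 1 = n - e by omega]
        by_cases h2 : m + e ≤ n + d
        · rw [if_pos ⟨h1, h2⟩, pairBelow, ← tsum_mul_left]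
          refine tsum_congr fun r => ?_
          rw [if_pos (by omega), if_pos (by omega), dualVertexWeight, if_pos (by omega),
            show n - e + e - n = 0 by omega]
          ring
        · rw [if_neg (fun h => h2 h.2)]
          refine (tsum_congr fun r => ?_).trans tsum_zero
          rw [if_neg (show ¬m ≤ n - e + d by omega), mul_zero]
      · rw [if_neg (by omega), if_neg (fun h => h1 h.1)]
  · intro l h1 h2
    refine (tsum_congr fun r => ?_).trans tsum_zero
    by_cases h3 : n ≤ l + e
    · rw [stripWeight_of_two_le (show 2 ≤ l + e - n by omega)]
      simp
    · simp [h3]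

theorem pairBelow_zero {q s x : ℂ} (hx : 1 + s * x ≠ 0) (y : ℂ) (e d : ℕ) :
    pairBelow q s x y e d 0 0 = if e = 0 ∧ d = 0 then 1 else 0 := by
  have hd := admissible_dualVertexWeight q s y
  have hs := admissible_stripWeight (q := q) hx
  rw [pairBelow, tsum_eq_single 0, rowWeight_zero hs, rowWeight_zero hd]
  · split_ifs <;> simp_all
  · intro r hr
    by_contra h
    have h1 := stateLE_of_rowWeight_ne_zero hd (right_ne_zero_of_mul h) 0
    rw [tailSum_zero] at h1
    exact hr (eq_zero_of_tailSum_zero (by omega))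

theorem pairAbove_zero_of_ne (q s x y : ℂ) {a b : ℕ} (hab : a ≠ b) :
    pairAbove q s x y a b 0 0 = 0 := by
  refine (tsum_congr fun r => ?_).trans tsum_zero
  by_contra h
  have h1 := rowWeight_total (left_ne_zero_of_mul h)
  have h2 := rowWeight_total (right_ne_zero_of_mul h)
  exact hab (by omega)

theorem pairAbove_zero_zero {q s x : ℂ} (hx : 1 + s * x ≠ 0) (y : ℂ) :
    pairAbove q s x y 0 0 0 0 = 1 := by
  have hd := admissible_dualVertexWeight q s y
  have hs := admissible_stripWeight (q := q) hx
  rw [pairAbove, tsum_eq_single 0, rowWeight_zero hs, rowWeight_zero hd]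
  · simp
  · intro r hr
    by_contra h
    have h1 := rowWeight_total (left_ne_zero_of_mul h)
    rw [tailSum_zero] at h1
    exact hr (eq_zero_of_tailSum_zero (by omega))

theorem pairAbove_zero_one {q s x : ℂ} (hx : 1 + s * x ≠ 0) (y : ℂ) :
    pairAbove q s x y 1 1 0 0 = (1 - q) / (1 + s * x) := by
  -- Only the configuration with all paths leaving upwards in the first column survives.
  have h := pairAbove_consState (q := q) hx y 1 1 0 0 0 0
  rw [consState_zero_zero] at h
  rw [h, dualFactorWeight_of_lt q s y (n := 0) (l := 0 + 1 + 1 - (0 + 1)) (by omega)]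
  simp [pairAbove_zero_zero hx, stripWeight, dualFactorWeight, numer, qPoch]

/-- The cross moves from the left of a pair of rows to its right, where it becomes trivial. -/
theorem pairAbove_eq {q s x : ℂ} (hr : Regular q s) (hx : 1 + s * x ≠ 0) (y : ℂ)
    (μ ν : ℕ →₀ ℕ) : ∀ a b, a ≤ 1 → pairAbove q s x y a b μ ν =
      crossWeight q s x y a b 0 * pairBelow q s x y 0 (b - a) μ ν +
        crossWeight q s x y a b 1 * pairBelow q s x y 1 (1 + b - a) μ ν := by
  refine state_induction₂ (P := fun μ ν => ∀ a b, a ≤ 1 → pairAbove q s x y a b μ ν =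
      crossWeight q s x y a b 0 * pairBelow q s x y 0 (b - a) μ ν +
        crossWeight q s x y a b 1 * pairBelow q s x y 1 (1 + b - a) μ ν) ?_ ?_ μ ν
  · intro a b ha
    rw [pairBelow_zero hx, pairBelow_zero hx]
    by_cases hab : a = b
    · subst hab
      interval_cases a
      · simp [pairAbove_zero_zero hx, crossWeight, hx]
      · simp [pairAbove_zero_one hx, crossWeight]
    · rw [pairAbove_zero_of_ne _ _ _ _ hab]
      interval_cases a
      · simp
        omega
      · rcases b with _ | _ | b
        · simp [crossWeight]
        · omega
        · simp
  · intro m n μ ν ih a b ha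
    rw [pairAbove_consState hx]
    -- With `a = 1` and `b = 0` the first cross weight vanishes.
    have hz : b < a → crossWeight q s x y a b 0 = 0 := by
      intro h
      obtain rfl : a = 1 := by omega
      obtain rfl : b = 0 := by omega
      simp [crossWeight]
    have hb0 := pairBelow_consState (q := q) hx y (Nat.zero_le 1) (b - a) m n μ ν
    have hb1 := pairBelow_consState (q := q) hx y le_rfl (1 + b - a) m n μ ν
    simp only [Nat.sub_zero] at hb0
    rw [Nat.add_sub_cancel] at hb1
    rcases le_or_gt (m + a) (n + b) with hle | hlt
    · obtain ⟨d, hd⟩ := Nat.exists_eq_add_of_le hle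
      have hz' := exchange_zero hr x y a ha hd
      have ho := exchange_one hr x y (d := d + 1) a ha (by omega : n + b + 1 = m + a + (d + 1))
      rw [if_pos (by omega), Nat.add_sub_cancel] at ho
      rw [if_pos (by omega), show n + (1 + b - a) - m = d + 1 by omega] at hb1
      rw [if_pos hle, show n + b - (m + a) = d by omega,
        show n + b + 1 - (m + a) = d + 1 by omega, ih 0 d (by omega), ih 1 (d + 1) le_rfl, hb1,
        Nat.sub_zero, Nat.sub_zero, Nat.add_sub_cancel, add_comm 1 d,
        show 1 + (d + 1) - 1 = d + 1 by omega]
      have e1 : (if 1 ≤ n ∧ m + 1 ≤ n + (1 + b - a) then stripWeight q s x (n - 1) 1 n 0 *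
          dualFactorWeight q s y (n - 1) (n - 1 + (1 + b - a) - m) *
          pairBelow q s x y 0 (n - 1 + (1 + b - a) - m) μ ν else 0) =
          (if 1 ≤ n then stripWeight q s x (n - 1) 1 n 0 * dualFactorWeight q s y (n - 1) d
            else 0) * pairBelow q s x y 0 d μ ν := by
        by_cases hn : 1 ≤ n
        · rw [if_pos hn, if_pos ⟨hn, by omega⟩, show n - 1 + (1 + b - a) - m = d by omega]
        · rw [if_neg hn, if_neg (fun h => hn h.1), zero_mul]
      have e2 : crossWeight q s x y a b 0 *
          pairBelow q s x y 0 (b - a) (consState m μ) (consState n ν) =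
          crossWeight q s x y a b 0 * (stripWeight q s x (n + 1) 0 n 1 *
            dualFactorWeight q s y (n + 1) (d + 1) * pairBelow q s x y 1 (d + 1) μ ν +
            stripWeight q s x n 0 n 0 * dualFactorWeight q s y n d *
              pairBelow q s x y 0 d μ ν) := by
        rcases lt_or_ge b a with hba | hba
        · rw [hz hba, zero_mul, zero_mul]
        · rw [hb0, if_pos (by omega), if_pos ⟨by omega, by omega⟩,
            show n + 1 + (b - a) - m = d + 1 by omega, show n + (b - a) - m = d by omega]
      rw [e1, e2]
      have e3 : (if 1 ≤ m + a ∧ m + a ≤ n + b + 1 then stripWeight q s x m a (m + a - 1) 1 *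
          dualFactorWeight q s y n (d + 1) * (crossWeight q s x y 1 (d + 1) 0 *
            pairBelow q s x y 0 d μ ν + crossWeight q s x y 1 (d + 1) 1 *
              pairBelow q s x y 1 (d + 1) μ ν) else 0) =
          (if 1 ≤ m + a then stripWeight q s x m a (m + a - 1) 1 *
            dualFactorWeight q s y n (d + 1) * crossWeight q s x y 1 (d + 1) 0 else 0) *
            pairBelow q s x y 0 d μ ν +
          (if 1 ≤ m + a then stripWeight q s x m a (m + a - 1) 1 *
            dualFactorWeight q s y n (d + 1) * crossWeight q s x y 1 (d + 1) 1 else 0) *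
            pairBelow q s x y 1 (d + 1) μ ν := by
        by_cases hm : 1 ≤ m + a
        · rw [if_pos hm, if_pos hm, if_pos ⟨hm, by omega⟩]
          ring
        · rw [if_neg hm, if_neg hm, if_neg (fun h => hm h.1)]
          ring
      rw [e3]
      linear_combination pairBelow q s x y 0 d μ ν * hz' + pairBelow q s x y 1 (d + 1) μ ν * ho
    · rw [if_neg (by omega), zero_add]
      by_cases hlt2 : m + a = n + b + 1
      · have ho := exchange_one hr x y (d := 0) a ha (by omega : n + b + 1 = m + a + 0)
        rw [if_neg (by omega), zero_add, if_pos (by omega)] at ho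
        rw [if_pos (by omega), show n + (1 + b - a) - m = 0 by omega, if_neg (by omega),
          add_zero] at hb1
        have e2 : crossWeight q s x y a b 0 *
            pairBelow q s x y 0 (b - a) (consState m μ) (consState n ν) =
            crossWeight q s x y a b 0 * (stripWeight q s x (n + 1) 0 n 1 *
              dualFactorWeight q s y (n + 1) 0 * pairBelow q s x y 1 0 μ ν) := by
          rcases lt_or_ge b a with hba | hba
          · rw [hz hba, zero_mul, zero_mul]
          · rw [hb0, if_pos (by omega), if_neg (by omega),
              show n + 1 + (b - a) - m = 0 by omega, add_zero]
        have e3 : crossWeight q s x y 1 0 0 = 0 := by simp [crossWeight]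
        rw [if_pos ⟨by omega, by omega⟩, show n + b + 1 - (m + a) = 0 by omega,
          ih 1 0 le_rfl, hb1, e2, e3]
        linear_combination pairBelow q s x y 1 0 μ ν * ho
      · rw [if_neg (by omega)]
        rw [if_neg (by omega), if_neg (by omega)] at hb1
        rw [hb1]
        rcases lt_or_ge b a with hba | hba
        · rw [hz hba]
          ring
        · rw [hb0, if_neg (by omega), if_neg (by omega)]
          ring

/-! ### Exchange of complete rows -/

/-- A complete row with at most one path on each horizontal edge. -/
def stripRow (q s x : ℂ) : (ℕ →₀ ℕ) → (ℕ →₀ ℕ) → ℂ :=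
  fullRow (stripWeight q s x) (stripBoundary x)

/-- The one-variable function `F_{λ/μ}(x)`, in terms of the states of `μ` and `λ`. -/
def whittakerRow (q s x : ℂ) : (ℕ →₀ ℕ) → (ℕ →₀ ℕ) → ℂ :=
  fullRow (vertexWeight q s x) (boundaryWeight q s x)

/-- The dual one-variable function `F*_{λ/μ}(y)`, in terms of the states of `μ` and `λ`. -/
def dualRow (q s y : ℂ) : (ℕ →₀ ℕ) → (ℕ →₀ ℕ) → ℂ :=
  fullRow (dualVertexWeight q s y) (boundaryWeight q s y)

theorem pairAbove_eq_zero (q s x y : ℂ) {a b : ℕ} {m n : ℕ →₀ ℕ}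
    (h : a + tailSum m 0 ≠ b + tailSum n 0) : pairAbove q s x y a b m n = 0 := by
  refine (tsum_congr fun r => ?_).trans tsum_zero
  by_contra h0
  have h1 := rowWeight_total (left_ne_zero_of_mul h0)
  have h2 := rowWeight_total (right_ne_zero_of_mul h0)
  omega

theorem pairBelow_eq_zero (q s x y : ℂ) {e d : ℕ} {m n : ℕ →₀ ℕ}
    (h : e + tailSum m 0 ≠ d + tailSum n 0) : pairBelow q s x y e d m n = 0 := by
  refine (tsum_congr fun r => ?_).trans tsum_zero
  by_contra h0
  have h1 := rowWeight_total (left_ne_zero_of_mul h0)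
  have h2 := rowWeight_total (right_ne_zero_of_mul h0)
  omega

theorem stripRow_eq_add (q s x : ℂ) (m r : ℕ →₀ ℕ) :
    stripRow q s x m r = rowWeight (stripWeight q s x) 0 m r +
      -x * rowWeight (stripWeight q s x) 1 m r := by
  rw [stripRow, fullRow]
  by_cases hle : tailSum m 0 ≤ tailSum r 0
  · obtain ⟨k, hk⟩ := Nat.exists_eq_add_of_le hle
    rw [show tailSum r 0 - tailSum m 0 = k by omega]
    rcases k with _ | _ | k
    · rw [rowWeight_eq_zero_of_ne (a := 1) (by omega)]
      simp [stripBoundary]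
    · rw [rowWeight_eq_zero_of_ne (a := 0) (by omega)]
      simp [stripBoundary]
    · rw [rowWeight_eq_zero_of_ne (a := 0) (by omega), rowWeight_eq_zero_of_ne (a := 1) (by omega)]
      simp [stripBoundary]
  · rw [rowWeight_eq_zero_of_ne (a := 0) (by omega), rowWeight_eq_zero_of_ne (a := 1) (by omega),
      rowWeight_eq_zero_of_ne (by omega)]
    simp

theorem rowWeight_mul_fullRow_above {w w' : ℕ → ℕ → ℕ → ℕ → ℂ} (β : ℕ → ℂ) (a : ℕ)
    (m n r : ℕ →₀ ℕ) : rowWeight w a m r * fullRow w' β n r =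
      β (a + tailSum m 0 - tailSum n 0) *
        (rowWeight w a m r * rowWeight w' (a + tailSum m 0 - tailSum n 0) n r) := by
  by_cases h : a + tailSum m 0 = tailSum r 0
  · rw [fullRow, h]
    ring
  · rw [rowWeight_eq_zero_of_ne h]
    ring

theorem rowWeight_mul_fullRow_below {w w' : ℕ → ℕ → ℕ → ℕ → ℂ} (β : ℕ → ℂ) (e : ℕ)
    (m n r : ℕ →₀ ℕ) : rowWeight w e r n * fullRow w' β r m =
      β (e + tailSum m 0 - tailSum n 0) *
        (rowWeight w e r n * rowWeight w' (e + tailSum m 0 - tailSum n 0) r m) := by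
  by_cases h : e + tailSum r 0 = tailSum n 0
  · rw [fullRow, show e + tailSum m 0 - tailSum n 0 = tailSum m 0 - tailSum r 0 by omega]
    ring
  · rw [rowWeight_eq_zero_of_ne h]
    ring

/-- In column `0` the cross is absorbed by the boundary weights, up to a constant. -/
theorem exchange_boundary {q s x : ℂ} (hr : Regular q s) (hx : 1 + s * x ≠ 0) (y : ℂ) (d : ℕ) :
    boundaryWeight q s y d * crossWeight q s x y 0 d 0 -
      x * (boundaryWeight q s y (d + 1) * crossWeight q s x y 1 (d + 1) 0) =
        (1 - x * y) / (1 + s * x) * boundaryWeight q s y d ∧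
    boundaryWeight q s y d * crossWeight q s x y 0 d 1 -
      x * (boundaryWeight q s y (d + 1) * crossWeight q s x y 1 (d + 1) 1) =
        (1 - x * y) / (1 + s * x) * (-x * boundaryWeight q s y (d + 1)) := by
  have h1 := hr.q_ne d
  have h2 := hr.q_pow d
  simp only [boundaryWeight, crossWeight, numer_succ, qPoch_succ, pow_succ']
  generalize hu : 1 - q * q ^ d = u at h2 ⊢
  constructor
  · field_simp
    subst hu
    ring
  · field_simp
    subst hu
    ring

/-- Exchange of a strip row with a dual row: by `pairAbove_eq` in the columns `1, 2, …` and by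
`exchange_boundary` in column `0`. -/
theorem stripRow_dualRow_exchange {q s x : ℂ} (hr : Regular q s) (hx : 1 + s * x ≠ 0) (y : ℂ)
    (m n : ℕ →₀ ℕ) : ∑' r, stripRow q s x m r * dualRow q s y n r =
      (1 - x * y) / (1 + s * x) * ∑' r, stripRow q s x r n * dualRow q s y r m := by
  have hd := admissible_dualVertexWeight q s y
  have hsum : ∀ a b, Summable fun r => rowWeight (stripWeight q s x) a m r *
      rowWeight (dualVertexWeight q s y) b n r := fun a b =>
    summable_of_hasFiniteSupport
      (finite_support_pairAbove hd (fun h => dualVertexWeight_le h) _ _ _ _)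
  have hsum' : ∀ a b, Summable fun r => rowWeight (stripWeight q s x) a r n *
      rowWeight (dualVertexWeight q s y) b r m := fun a b =>
    summable_of_hasFiniteSupport ((finite_setOf_stateLE m).subset fun _ hr =>
      stateLE_of_rowWeight_ne_zero hd (right_ne_zero_of_mul hr))
  have hL : ∑' r, stripRow q s x m r * dualRow q s y n r =
      boundaryWeight q s y (0 + tailSum m 0 - tailSum n 0) *
        pairAbove q s x y 0 (0 + tailSum m 0 - tailSum n 0) m n +
      -x * boundaryWeight q s y (1 + tailSum m 0 - tailSum n 0) *
        pairAbove q s x y 1 (1 + tailSum m 0 - tailSum n 0) m n := by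
    rw [pairAbove, pairAbove, ← tsum_mul_left, ← tsum_mul_left,
      ← ((hsum _ _).mul_left _).tsum_add ((hsum _ _).mul_left _)]
    refine tsum_congr fun r => ?_
    rw [stripRow_eq_add, add_mul, mul_assoc, dualRow, rowWeight_mul_fullRow_above,
      rowWeight_mul_fullRow_above]
    ring
  have hR : ∑' r, stripRow q s x r n * dualRow q s y r m =
      boundaryWeight q s y (0 + tailSum m 0 - tailSum n 0) *
        pairBelow q s x y 0 (0 + tailSum m 0 - tailSum n 0) m n +
      -x * boundaryWeight q s y (1 + tailSum m 0 - tailSum n 0) *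
        pairBelow q s x y 1 (1 + tailSum m 0 - tailSum n 0) m n := by
    rw [pairBelow, pairBelow, ← tsum_mul_left, ← tsum_mul_left,
      ← ((hsum' _ _).mul_left _).tsum_add ((hsum' _ _).mul_left _)]
    refine tsum_congr fun r => ?_
    rw [stripRow_eq_add, add_mul, mul_assoc, dualRow, rowWeight_mul_fullRow_below,
      rowWeight_mul_fullRow_below]
    ring
  rw [hL, hR]
  rcases le_or_gt (tailSum n 0) (tailSum m 0) with hle | hlt
  · obtain ⟨d, h⟩ := Nat.exists_eq_add_of_le hle
    obtain ⟨e0, e1⟩ := exchange_boundary hr hx y d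
    rw [show 0 + tailSum m 0 - tailSum n 0 = d by omega,
      show 1 + tailSum m 0 - tailSum n 0 = d + 1 by omega, pairAbove_eq hr hx y m n _ _ zero_le_one,
      pairAbove_eq hr hx y m n _ _ le_rfl, Nat.sub_zero, Nat.sub_zero, Nat.add_sub_cancel,
      show 1 + (d + 1) - 1 = d + 1 by omega, add_comm 1 d]
    linear_combination pairBelow q s x y 0 d m n * e0 + pairBelow q s x y 1 (d + 1) m n * e1
  · rw [pairAbove_eq_zero q s x y (a := 0) (by omega),
      pairBelow_eq_zero q s x y (e := 0) (by omega)]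
    by_cases h : tailSum n 0 = 1 + tailSum m 0
    · rw [show 1 + tailSum m 0 - tailSum n 0 = 0 by omega, pairAbove_eq hr hx y m n _ _ le_rfl]
      simp only [crossWeight, pow_zero, sub_self, zero_div, zero_mul, zero_add, mul_zero]
      rw [show 1 + 0 - 1 = 0 from rfl]
      ring
    · rw [pairAbove_eq_zero q s x y (a := 1) (by omega),
        pairBelow_eq_zero q s x y (e := 1) (by omega)]
      ring

/-! ### Shifting the parameter of a row -/

theorem vertexWeight_of_lt (q s x : ℂ) {i j k l : ℕ} (h : i < l) :
    vertexWeight q s x i j k l = 0 := if_neg fun h2 => by omega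

theorem vertexWeight_eq (q s x : ℂ) {i j k l p : ℕ} (h : i + j = k + l) (hp : i = l + p) :
    vertexWeight q s x i j k l = numer q s x l * qPoch q (-s * x) p * qPoch q q k /
      (qPoch q q l * qPoch q q p * qPoch q (s ^ 2) k) := by
  rw [vertexWeight, if_pos ⟨h, by omega⟩, show i - l = p by omega]

/-- A strip vertex below a vertex of parameter `x` is a vertex of parameter `q * x`. -/
theorem strip_mul_vertexWeight {q s x : ℂ} (hr : Regular q s) (hx : 1 + s * x ≠ 0)
    {m e l a p : ℕ} (he : e ≤ 1) (h : l + p = m + e + a) :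
    stripWeight q s x m e (m + e) 0 * vertexWeight q s x (m + e) a l p +
      (if 1 ≤ m + e ∧ 1 ≤ p then
        stripWeight q s x m e (m + e - 1) 1 * vertexWeight q s x (m + e - 1) a l (p - 1) else 0) =
      vertexWeight q s (q * x) m (a + e) l p := by
  have hl := hr.s_ne l
  have hL := hr.q_ne l
  have hA : ∀ j, qPoch q (-s * (q * x)) j = qPoch q (-s * x) j * (1 + s * x * q ^ j) /
      (1 + s * x) := by
    intro j
    rw [eq_div_iff hx, show -s * (q * x) = -s * x * q by ring]
    linear_combination qPoch_mul_left q (-s * x) j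
  rcases p with _ | k
  · rw [if_neg (by omega), add_zero, vertexWeight_eq (p := m + e) _ _ _ (by omega) (by omega),
      vertexWeight_eq (p := m) _ _ _ (by omega) (by omega), hA]
    have h1 := hr.q_ne m
    have h2 := hr.q_pow m
    interval_cases e
    · simp only [stripWeight, add_zero, if_true, numer_zero, qPoch_zero]
      field_simp
    · simp only [stripWeight, if_true, numer_zero, qPoch_succ, qPoch_zero, pow_succ']
      field_simp
      ring
  · have hk := hr.q_ne k
    have hk1 := hr.q_pow k
    rw [Nat.add_sub_cancel]
    rcases lt_trichotomy (m + e) (k + 1) with hlt | heq | hgt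
    · rw [vertexWeight_of_lt _ _ _ hlt, vertexWeight_of_lt q s (q * x) (by omega)]
      split_ifs
      · rw [vertexWeight_of_lt _ _ _ (by omega)]
        ring
      · ring
    · rw [if_pos (by omega), vertexWeight_eq (p := 0) _ _ _ (by omega) (by omega),
        vertexWeight_eq (p := 0) _ _ _ (by omega) (by omega)]
      interval_cases e
      · obtain rfl : m = k + 1 := by omega
        rw [vertexWeight_eq (p := 0) _ _ _ (by omega) (by omega)]
        rw [numer_mul_left]
        simp only [stripWeight, add_zero, if_true, numer_succ, qPoch_succ,
          qPoch_zero, Nat.add_sub_cancel, pow_succ']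
        field_simp
        ring
      · obtain rfl : m = k := by omega
        rw [vertexWeight_of_lt q s (q * x) (by omega)]
        simp only [stripWeight, if_true, numer_succ, qPoch_succ, qPoch_zero, Nat.add_sub_cancel,
          pow_succ']
        field_simp
        ring
    · obtain ⟨j, hj⟩ := Nat.exists_eq_add_of_le (show k + 1 ≤ m by omega)
      have h1 := hr.q_ne j
      have h2 := hr.q_pow j
      rw [if_pos (by omega), vertexWeight_eq (p := j + e) _ _ _ (by omega) (by omega),
        vertexWeight_eq (p := j + e) _ _ _ (by omega) (by omega),
        vertexWeight_eq (p := j) _ _ _ (by omega) (by omega), hA]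
      subst hj
      interval_cases e
      · rw [numer_mul_left]
        simp only [stripWeight, add_zero, if_true, numer_succ, qPoch_succ,
          show k + 1 + j - 1 + 1 = k + 1 + j by omega, pow_succ', pow_add]
        rw [show k + 1 + j - 1 = k + j by omega]
        simp only [pow_add]
        field_simp
        ring
      · rw [numer_mul_left]
        simp only [stripWeight, if_true, numer_succ, qPoch_succ,
          Nat.add_sub_cancel, pow_succ', pow_add]
        generalize hu : 1 - q * q ^ k = u at hk1 ⊢
        generalize hv : 1 - q * q ^ j = v at h2 ⊢
        field_simp
        subst hu hv
        ring

theorem tsum_strip_mul_rowWeight {q s x : ℂ} (hr : Regular q s) (hx : 1 + s * x ≠ 0)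
    (μ ν : ℕ →₀ ℕ) : ∀ e a, e ≤ 1 →
      ∑' r, rowWeight (stripWeight q s x) e μ r * rowWeight (vertexWeight q s x) a r ν =
        rowWeight (vertexWeight q s (q * x)) (a + e) μ ν := by
  have hs := admissible_stripWeight (q := q) hx
  have hv := admissible_vertexWeight q s
  refine state_induction₂ (P := fun μ ν => ∀ e a, e ≤ 1 →
    ∑' r, rowWeight (stripWeight q s x) e μ r * rowWeight (vertexWeight q s x) a r ν =
      rowWeight (vertexWeight q s (q * x)) (a + e) μ ν) ?_ ?_ μ ν
  · intro e a _
    rw [tsum_eq_single 0, rowWeight_zero hs, rowWeight_zero (hv _), rowWeight_zero (hv _)]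
    · split_ifs <;> simp_all
    · intro r hr
      by_contra h
      have h1 := stateLE_of_rowWeight_ne_zero (hv _) (right_ne_zero_of_mul h) 0
      rw [tailSum_zero] at h1
      exact hr (eq_zero_of_tailSum_zero (by omega))
  · intro m l μ ν ih e a he
    rw [tsum_consState (finite_support_rowWeight_mul (hv _) _ _ _ _)]
    simp only [rowWeight_consState hs, rowWeight_consState (hv _)]
    rw [tsum_eq_add_pred _ (m + e)]
    · by_cases h1 : l ≤ m + (a + e)
      · have h2 := strip_mul_vertexWeight hr hx (m := m) (l := l) (a := a)
          (p := m + (a + e) - l) he (by omega)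
        rw [if_pos h1, ← h2, add_mul]
        congr 1
        · rw [← Nat.add_zero (m + (a + e) - l), ← ih 0 (m + (a + e) - l) (by omega),
            ← tsum_mul_left]
          refine tsum_congr fun r => ?_
          rw [if_pos le_rfl, if_pos (by omega), Nat.sub_self, Nat.add_zero,
            show m + e + a - l = m + (a + e) - l by omega]
          ring
        · by_cases h3 : 1 ≤ m + e
          · rw [if_pos h3]
            by_cases h4 : 1 ≤ m + (a + e) - l
            · rw [if_pos ⟨h3, h4⟩]
              obtain ⟨p, hp⟩ := Nat.exists_eq_add_of_le' h4
              rw [hp, Nat.add_sub_cancel, ← ih 1 p le_rfl, ← tsum_mul_left]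
              refine tsum_congr fun r => ?_
              rw [if_pos (by omega), if_pos (by omega), show m + e - (m + e - 1) = 1 by omega,
                show m + e - 1 + a - l = p by omega]
              ring
            · rw [if_neg (fun h => h4 h.2), zero_mul]
              refine (tsum_congr fun r => ?_).trans tsum_zero
              rw [if_neg (show ¬l ≤ m + e - 1 + a by omega), mul_zero]
          · rw [if_neg h3, if_neg (fun h => h3 h.1), zero_mul]
      · rw [if_neg h1]
        have h4 : ∀ r : ℕ →₀ ℕ, ∀ k, k ≤ m + e → (if l ≤ k + a then vertexWeight q s x k a l
            (k + a - l) * rowWeight (vertexWeight q s x) (k + a - l) r ν else 0) = 0 :=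
          fun r k hk => if_neg (by omega)
        simp only [h4 _ _ le_rfl, h4 _ _ (Nat.sub_le _ 1), mul_zero, tsum_zero, ite_self, add_zero]
    · intro k h1 h2
      refine (tsum_congr fun r => ?_).trans tsum_zero
      by_cases h3 : k ≤ m + e
      · rw [stripWeight_of_two_le (show 2 ≤ m + e - k by omega)]
        simp
      · simp [h3]

theorem boundaryWeight_shift {q s : ℂ} (hr : Regular q s) (x : ℂ) (l : ℕ) :
    boundaryWeight q s x (l + 1) - x * boundaryWeight q s x l =
      boundaryWeight q s (q * x) (l + 1) := by
  have h1 := hr.q_ne l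
  have h2 := hr.q_pow l
  simp only [boundaryWeight]
  rw [numer_mul_left]
  simp only [numer_succ, qPoch_succ]
  generalize hu : 1 - q * q ^ l = u at h2 ⊢
  field_simp
  subst hu
  ring

theorem rowWeight_mul_fullRow {w w' : ℕ → ℕ → ℕ → ℕ → ℂ} (β : ℕ → ℂ) (e : ℕ)
    (m n r : ℕ →₀ ℕ) : rowWeight w e m r * fullRow w' β r n =
      β (tailSum n 0 - tailSum m 0 - e) *
        (rowWeight w e m r * rowWeight w' (tailSum n 0 - tailSum m 0 - e) r n) := by
  by_cases h : e + tailSum m 0 = tailSum r 0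
  · rw [fullRow, show tailSum n 0 - tailSum r 0 = tailSum n 0 - tailSum m 0 - e by omega]
    ring
  · rw [rowWeight_eq_zero_of_ne h]
    ring

/-- A strip row followed by a row of parameter `x` is a row of parameter `q * x`. -/
theorem tsum_stripRow_mul_whittakerRow {q s x : ℂ} (hr : Regular q s) (hx : 1 + s * x ≠ 0)
    (m n : ℕ →₀ ℕ) :
    ∑' r, stripRow q s x m r * whittakerRow q s x r n = whittakerRow q s (q * x) m n := by
  have hv := admissible_vertexWeight q s
  have hsum : ∀ e a, Summable fun r => rowWeight (stripWeight q s x) e m r *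
      rowWeight (vertexWeight q s x) a r n := fun e a =>
    summable_of_hasFiniteSupport (finite_support_rowWeight_mul (hv _) _ _ _ _)
  have hL : ∑' r, stripRow q s x m r * whittakerRow q s x r n =
      boundaryWeight q s x (tailSum n 0 - tailSum m 0 - 0) *
        rowWeight (vertexWeight q s (q * x)) (tailSum n 0 - tailSum m 0 - 0 + 0) m n +
      -x * boundaryWeight q s x (tailSum n 0 - tailSum m 0 - 1) *
        rowWeight (vertexWeight q s (q * x)) (tailSum n 0 - tailSum m 0 - 1 + 1) m n := by
    rw [← tsum_strip_mul_rowWeight hr hx m n 0 _ zero_le_one,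
      ← tsum_strip_mul_rowWeight hr hx m n 1 _ le_rfl, ← tsum_mul_left, ← tsum_mul_left,
      ← ((hsum _ _).mul_left _).tsum_add ((hsum _ _).mul_left _)]
    refine tsum_congr fun r => ?_
    rw [stripRow_eq_add, add_mul, mul_assoc, whittakerRow, rowWeight_mul_fullRow,
      rowWeight_mul_fullRow]
    ring
  rw [hL, whittakerRow, fullRow, Nat.sub_zero, Nat.add_zero]
  rcases hk : tailSum n 0 - tailSum m 0 with _ | k
  · rw [rowWeight_eq_zero_of_ne (a := 0 - 1 + 1) (fun h => by omega)]
    simp [boundaryWeight, numer_zero]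
  · rw [Nat.add_sub_cancel, ← boundaryWeight_shift hr]
    ring

/-- For `x = -s` no path moves to the right, since `numer q s (-s) l` vanishes for `l ≥ 1`. -/
theorem whittakerRow_neg {q s : ℂ} (hr : Regular q s) (m n : ℕ →₀ ℕ) :
    whittakerRow q s (-s) m n = if m = n then 1 else 0 := by
  have hv := admissible_vertexWeight q s (-s)
  have h0 : ∀ l, numer q s (-s) (l + 1) = 0 := fun l => by
    rw [numer, Finset.prod_range_succ']
    simp
  split_ifs with h
  · subst h
    simp only [whittakerRow, fullRow, rowWeight, Nat.sub_self, zero_add, if_true]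
    rw [finprod_eq_one_of_forall_eq_one]
    · simp [boundaryWeight, numer_zero, qPoch_zero]
    · intro c
      have h1 := hr.q_ne (m c)
      have h2 := hr.s_ne (m c)
      rw [vertexWeight, if_pos (by simp), show -s * -s = s ^ 2 by ring, numer_zero, qPoch_zero,
        Nat.sub_zero]
      field_simp
  · by_contra hne
    refine h (eq_of_tailSum_eq fun c => ?_)
    have hle := stateLE_of_fullRow_ne_zero hv hne
    have h1 : ∀ c, tailSum n c - tailSum m c = 0 := by
      intro c
      rcases c with _ | c
      · by_contra hc
        obtain ⟨k, hk⟩ := Nat.exists_eq_succ_of_ne_zero hc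
        exact left_ne_zero_of_mul hne (by rw [hk, boundaryWeight, h0, zero_div])
      · by_contra hc
        obtain ⟨k, hk⟩ := Nat.exists_eq_succ_of_ne_zero hc
        refine rowWeight_factor_ne_zero hv (right_ne_zero_of_mul hne) c ?_
        rw [hk, vertexWeight, h0]
        simp
    have := hle c
    have := h1 c
    omega

/-! ### Kernels on states -/

/-- Composition of kernels on states. -/
def kernelComp (A A' : (ℕ →₀ ℕ) → (ℕ →₀ ℕ) → ℂ) (m l : ℕ →₀ ℕ) : ℂ := ∑' r, A m r * A' r l

/-- The kernel vanishes unless the second state contains the first one. -/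
def Increasing (A : (ℕ →₀ ℕ) → (ℕ →₀ ℕ) → ℂ) : Prop := ∀ m l, A m l ≠ 0 → StateLE m l

/-- The kernel adds a bounded number of columns to the states with at most `N` columns. -/
def Narrow (A : (ℕ →₀ ℕ) → (ℕ →₀ ℕ) → ℂ) : Prop :=
  ∀ N, ∃ N', ∀ m l, tailSum m N = 0 → A m l ≠ 0 → tailSum l N' = 0

/-- The number of boxes in the first `N` rows of the Young diagram of a state. -/
def stateSize (N : ℕ) (f : ℕ →₀ ℕ) : ℕ := ∑ c ∈ Finset.range N, tailSum f c

/-- The kernel decays at least like `r ^ (|l| - |m|)`, uniformly on states with at most `N`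
columns. -/
def TameAt (r : ℝ) (A : (ℕ →₀ ℕ) → (ℕ →₀ ℕ) → ℂ) : Prop :=
  ∀ N, ∃ K : ℝ, ∀ m l, tailSum l N = 0 → ‖A m l‖ * r ^ stateSize N m ≤ K * r ^ stateSize N l

/-- The kernel decays exponentially, at every rate close enough to one.  Allowing all these rates
makes the notion stable under composition. -/
def Tame (A : (ℕ →₀ ℕ) → (ℕ →₀ ℕ) → ℂ) : Prop :=
  ∃ r₀ < 1, ∀ r, r₀ < r → r < 1 → TameAt r A

/-- The skew Cauchy identity for two kernels, with the constant `C`.  The dual of `B` is the kernel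
`D l / D n * B n l`; to keep the relation symmetric in `A` and `B`, both sides are multiplied by
`D n`. -/
def SkewCauchy (D : (ℕ →₀ ℕ) → ℂ) (A B : (ℕ →₀ ℕ) → (ℕ →₀ ℕ) → ℂ) (C : ℂ) : Prop :=
  ∀ m n, HasSum (fun l => A m l * B n l * D l)
    (C * ∑' k, A k n * B k m * (D m * D n / D k))

theorem SkewCauchy.symm {D : (ℕ →₀ ℕ) → ℂ} {A B : (ℕ →₀ ℕ) → (ℕ →₀ ℕ) → ℂ} {C : ℂ}
    (h : SkewCauchy D A B C) : SkewCauchy D B A C := by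
  intro m n
  convert h n m using 2
  · ring
  · refine tsum_congr fun k => ?_
    ring

theorem tailSum_zero_eq (f : ℕ →₀ ℕ) (N : ℕ) :
    tailSum f 0 = ∑ c ∈ Finset.range N, f c + tailSum f N := by
  induction N with
  | zero => simp
  | succ N ih => rw [ih, Finset.sum_range_succ, tailSum_succ f N, add_assoc]

theorem summable_pow_tailSum {t : ℝ} (h0 : 0 ≤ t) (h1 : t < 1) (N : ℕ) :
    Summable fun f : ℕ →₀ ℕ => if tailSum f N = 0 then t ^ tailSum f 0 else 0 := by
  induction N with
  | zero =>
    refine summable_of_hasFiniteSupport ((Set.finite_singleton 0).subset fun f hf => ?_)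
    by_contra hne
    refine hf (if_neg fun h => hne ?_)
    exact eq_zero_of_tailSum_zero h
  | succ N ih =>
    rw [← consEquiv.summable_iff]
    refine ((summable_geometric_of_lt_one h0 h1).mul_of_nonneg ih (fun n => by positivity)
      (fun f => by positivity)).congr fun p => ?_
    simp only [Function.comp_apply, consEquiv, Equiv.coe_fn_mk, tailSum_consState_succ,
      tailSum_consState_zero, pow_add]
    split_ifs <;> simp

/-- The state with values `tailSum l c - tailSum m c` in the first `N` columns. -/
def diffState (N : ℕ) (l m : ℕ →₀ ℕ) : ℕ →₀ ℕ :=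
  Finsupp.onFinset (Finset.range N) (fun c => if c < N then tailSum l c - tailSum m c else 0)
    fun c hc => by
      rw [Finset.mem_range]
      by_contra h
      exact hc (if_neg h)

theorem tailSum_diffState (N : ℕ) (l m : ℕ →₀ ℕ) : tailSum (diffState N l m) N = 0 := by
  rw [tailSum, Finsupp.sum]
  refine Finset.sum_eq_zero fun c hc => if_neg ?_
  have := Finsupp.support_onFinset_subset hc
  rw [Finset.mem_range] at this
  omega

theorem tailSum_diffState_zero {N : ℕ} {l m : ℕ →₀ ℕ} (h : StateLE m l) :
    tailSum (diffState N l m) 0 + stateSize N m = stateSize N l := by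
  rw [tailSum_zero_eq _ N, tailSum_diffState, add_zero, stateSize, stateSize,
    ← Finset.sum_add_distrib]
  refine Finset.sum_congr rfl fun c hc => ?_
  have := h c
  rw [diffState, Finsupp.onFinset_apply, if_pos (Finset.mem_range.1 hc)]
  omega

theorem diffState_inj {N : ℕ} {l l' m : ℕ →₀ ℕ} (h : StateLE m l) (h' : StateLE m l')
    (hl : tailSum l N = 0) (hl' : tailSum l' N = 0)
    (heq : diffState N l m = diffState N l' m) : l = l' := by
  refine eq_of_tailSum_eq fun c => ?_
  rcases lt_or_ge c N with hc | hc
  · have h1 := DFunLike.congr_fun heq c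
    have := h c
    have := h' c
    rw [diffState, diffState, Finsupp.onFinset_apply, Finsupp.onFinset_apply, if_pos hc,
      if_pos hc] at h1
    omega
  · have h1 := tailSum_anti l hc
    have h2 := tailSum_anti l' hc
    omega

theorem stateLE_zero (f : ℕ →₀ ℕ) : StateLE 0 f := fun c => by simp

theorem StateLE.tailSum_eq_zero {f g : ℕ →₀ ℕ} (h : StateLE f g) {N : ℕ} (hg : tailSum g N = 0) :
    tailSum f N = 0 := by
  have := h N
  omega

theorem stateSize_mono {N : ℕ} {f g : ℕ →₀ ℕ} (h : StateLE f g) : stateSize N f ≤ stateSize N g :=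
  Finset.sum_le_sum fun c _ => h c

/-- The sum of `t ^ (|l| - |m|)` over the states containing `m` is bounded uniformly in `m`. -/
theorem sum_pow_diffState_le {t : ℝ} (h0 : 0 ≤ t) (h1 : t < 1) (N : ℕ) (m : ℕ →₀ ℕ)
    (s : Finset (ℕ →₀ ℕ)) (hs : ∀ l ∈ s, StateLE m l ∧ tailSum l N = 0) :
    ∑ l ∈ s, t ^ tailSum (diffState N l m) 0 ≤
      ∑' f : ℕ →₀ ℕ, if tailSum f N = 0 then t ^ tailSum f 0 else 0 := by
  have hinj : Set.InjOn (fun l => diffState N l m) s := fun l hl l' hl' heq =>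
    diffState_inj (hs l hl).1 (hs l' hl').1 (hs l hl).2 (hs l' hl').2 heq
  refine le_trans (le_of_eq ?_) ((summable_pow_tailSum h0 h1 N).sum_le_tsum
    (s.image fun l => diffState N l m) fun f _ => by positivity)
  rw [Finset.sum_image hinj]
  exact Finset.sum_congr rfl fun l _ => (if_pos (tailSum_diffState N l m)).symm

theorem summable_pow_stateSize {r : ℝ} (h0 : 0 ≤ r) (h1 : r < 1) (N : ℕ) :
    Summable fun f : ℕ →₀ ℕ => if tailSum f N = 0 then r ^ stateSize N f else 0 := by
  refine summable_of_sum_le (c := ∑' f : ℕ →₀ ℕ, if tailSum f N = 0 then r ^ tailSum f 0 else 0)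
    (fun f => by positivity) fun u => ?_
  rw [← Finset.sum_filter]
  refine le_trans (le_of_eq (Finset.sum_congr rfl fun l hl => ?_))
    (sum_pow_diffState_le h0 h1 N 0 (u.filter fun l => tailSum l N = 0) fun l hl =>
      ⟨stateLE_zero l, (Finset.mem_filter.1 hl).2⟩)
  have := tailSum_diffState_zero (N := N) (stateLE_zero l)
  have h0 : stateSize N 0 = 0 := by simp [stateSize]
  rw [← this, h0, add_zero]

theorem kernelComp_ne_zero {A A' : (ℕ →₀ ℕ) → (ℕ →₀ ℕ) → ℂ} {m l : ℕ →₀ ℕ}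
    (h : kernelComp A A' m l ≠ 0) : ∃ r, A m r ≠ 0 ∧ A' r l ≠ 0 := by
  by_contra! hne
  refine h ((tsum_congr fun r => ?_).trans tsum_zero)
  by_cases hr : A m r = 0
  · rw [hr, zero_mul]
  · rw [hne r hr, mul_zero]

theorem Increasing.comp {A A' : (ℕ →₀ ℕ) → (ℕ →₀ ℕ) → ℂ} (h : Increasing A)
    (h' : Increasing A') : Increasing (kernelComp A A') := fun m l hne => by
  obtain ⟨r, h1, h2⟩ := kernelComp_ne_zero hne
  exact (h m r h1).trans (h' r l h2)

theorem Narrow.comp {A A' : (ℕ →₀ ℕ) → (ℕ →₀ ℕ) → ℂ} (h : Narrow A) (h' : Narrow A') :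
    Narrow (kernelComp A A') := fun N => by
  obtain ⟨N1, h1⟩ := h N
  obtain ⟨N2, h2⟩ := h' N1
  refine ⟨N2, fun m l hm hne => ?_⟩
  obtain ⟨r, h3, h4⟩ := kernelComp_ne_zero hne
  exact h2 r l (h1 m r hm h3) h4

/-- The states contained in `f`. -/
def below (f : ℕ →₀ ℕ) : Finset (ℕ →₀ ℕ) := (finite_setOf_stateLE f).toFinset

theorem mem_below {f g : ℕ →₀ ℕ} : g ∈ below f ↔ StateLE g f := by simp [below]

theorem kernelComp_eq_sum {A' : (ℕ →₀ ℕ) → (ℕ →₀ ℕ) → ℂ} (h : Increasing A')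
    (A : (ℕ →₀ ℕ) → (ℕ →₀ ℕ) → ℂ) (m l : ℕ →₀ ℕ) :
    kernelComp A A' m l = ∑ r ∈ below l, A m r * A' r l := by
  refine tsum_eq_sum fun r hr => ?_
  by_contra hne
  exact hr (mem_below.2 (h _ _ (right_ne_zero_of_mul hne)))

theorem Tame.comp {A A' : (ℕ →₀ ℕ) → (ℕ →₀ ℕ) → ℂ} (hA : Increasing A) (hA' : Increasing A')
    (h : Tame A) (h' : Tame A') : Tame (kernelComp A A') := by
  obtain ⟨r0, h0, hr⟩ := h
  obtain ⟨r0', h0', hr'⟩ := h'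
  refine ⟨max 0 (max r0 r0'), by simp [h0, h0'], fun r h1 h2 N => ?_⟩
  simp only [max_lt_iff] at h1
  -- An intermediate rate makes room for the sum over the intermediate states.
  obtain ⟨t, ht1, ht2⟩ := exists_between (show max 0 r0 < r from max_lt h1.1 h1.2.1)
  rw [max_lt_iff] at ht1
  obtain ⟨K, hK⟩ := hr t ht1.2 (ht2.trans h2) N
  obtain ⟨K', hK'⟩ := hr' r h1.2.2 h2 N
  have hu0 : 0 ≤ t / r := div_nonneg ht1.1.le h1.1.le
  have hu1 : t / r < 1 := (div_lt_one h1.1).2 ht2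
  set M := ∑' f : ℕ →₀ ℕ, if tailSum f N = 0 then (t / r) ^ tailSum f 0 else 0
  refine ⟨|K| * |K'| * M, fun m l hl => ?_⟩
  rw [kernelComp_eq_sum hA']
  classical
  rw [← Finset.sum_filter_of_ne (p := fun k => StateLE m k)
    fun k _ hne => hA _ _ (left_ne_zero_of_mul hne)]
  have hrm : (0 : ℝ) ≤ r ^ stateSize N m := pow_nonneg h1.1.le _
  calc ‖∑ k ∈ (below l).filter (fun k => StateLE m k), A m k * A' k l‖ * r ^ stateSize N m
      ≤ ∑ k ∈ (below l).filter (fun k => StateLE m k),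
          |K| * |K'| * r ^ stateSize N l * (t / r) ^ tailSum (diffState N k m) 0 := by
        refine (mul_le_mul_of_nonneg_right (norm_sum_le _ _) hrm).trans ?_
        rw [Finset.sum_mul]
        refine Finset.sum_le_sum fun k hk => ?_
        rw [Finset.mem_filter, mem_below] at hk
        have e1 := hK m k (hk.1.tailSum_eq_zero hl)
        have e2 := hK' k l hl
        have e3 := tailSum_diffState_zero (N := N) hk.2
        have p1 : 0 < t ^ stateSize N m := pow_pos ht1.1 _
        have p2 : 0 < r ^ stateSize N k := pow_pos h1.1 _
        have e1' : ‖A m k‖ ≤ |K| * t ^ tailSum (diffState N k m) 0 := by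
          refine le_of_mul_le_mul_right (e1.trans ?_) p1
          rw [mul_assoc, ← pow_add, e3]
          exact mul_le_mul_of_nonneg_right (le_abs_self K) (pow_nonneg ht1.1.le _)
        have e4 : r ^ tailSum (diffState N k m) 0 * r ^ stateSize N m = r ^ stateSize N k := by
          rw [← pow_add, e3]
        have e5 : r ^ tailSum (diffState N k m) 0 ≠ 0 := (pow_pos h1.1 _).ne'
        rw [norm_mul]
        calc ‖A m k‖ * ‖A' k l‖ * r ^ stateSize N m
            ≤ |K| * t ^ tailSum (diffState N k m) 0 * ‖A' k l‖ * r ^ stateSize N m := by gcongr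
          _ = |K| * (t / r) ^ tailSum (diffState N k m) 0 *
              (‖A' k l‖ * r ^ stateSize N k) := by
              rw [← e4, div_pow]
              field_simp
          _ ≤ |K| * (t / r) ^ tailSum (diffState N k m) 0 * (|K'| * r ^ stateSize N l) := by
              refine mul_le_mul_of_nonneg_left (e2.trans ?_) (by positivity)
              exact mul_le_mul_of_nonneg_right (le_abs_self K') (pow_nonneg h1.1.le _)
          _ = _ := by ring
    _ ≤ |K| * |K'| * r ^ stateSize N l * M := by
        rw [← Finset.mul_sum]
        refine mul_le_mul_of_nonneg_left (sum_pow_diffState_le hu0 hu1 N m _ fun k hk => ?_)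
          (mul_nonneg (by positivity) (pow_nonneg h1.1.le _))
        rw [Finset.mem_filter, mem_below] at hk
        exact ⟨hk.2, hk.1.tailSum_eq_zero hl⟩
    _ = _ := by ring

/-- The identity kernel. -/
def idKernel (m l : ℕ →₀ ℕ) : ℂ := if m = l then 1 else 0

theorem SkewCauchy.of_id {D : (ℕ →₀ ℕ) → ℂ} (hD : ∀ f, D f ≠ 0)
    (B : (ℕ →₀ ℕ) → (ℕ →₀ ℕ) → ℂ) : SkewCauchy D idKernel B 1 := by
  intro m n
  rw [tsum_eq_single n fun k hk => by rw [idKernel, if_neg hk]; ring, idKernel, if_pos rfl]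
  have h : HasSum (fun l => idKernel m l * B n l * D l) (idKernel m m * B n m * D m) :=
    hasSum_single m fun l hl => by rw [idKernel, if_neg hl.symm]; ring
  convert h using 1
  have := hD n
  rw [idKernel, if_pos rfl]
  field_simp

/-- Absolute convergence of the double sum over two consecutive rows and a dual row. -/
theorem summable_comp_mul {D : (ℕ →₀ ℕ) → ℂ} {A A' B : (ℕ →₀ ℕ) → (ℕ →₀ ℕ) → ℂ}
    (hDb : ∀ N, ∃ K : ℝ, ∀ f, tailSum f N = 0 → ‖D f‖ ≤ K) (hA' : Increasing A')
    (hBn : Narrow B) (tA : Tame A) (tA' : Tame A') (tB : Tame B) (m n : ℕ →₀ ℕ) :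
    Summable fun p : (ℕ →₀ ℕ) × (ℕ →₀ ℕ) => A m p.1 * A' p.1 p.2 * (B n p.2 * D p.2) := by
  obtain ⟨r1, l1, b1⟩ := tA
  obtain ⟨r2, l2, b2⟩ := tA'
  obtain ⟨r3, l3, b3⟩ := tB
  obtain ⟨r, hr, hr1⟩ := exists_between
    (show max (max 0 r1) (max r2 r3) < 1 by simp [l1, l2, l3])
  simp only [max_lt_iff] at hr
  obtain ⟨⟨hr0, hh1⟩, hh2, hh3⟩ := hr
  obtain ⟨N0, hN0⟩ := exists_tailSum_eq_zero n
  obtain ⟨N, hN⟩ := hBn N0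
  obtain ⟨K1, hK1⟩ := b1 r hh1 hr1 N
  obtain ⟨K2, hK2⟩ := b2 r hh2 hr1 N
  obtain ⟨K3, hK3⟩ := b3 r hh3 hr1 N
  obtain ⟨K4, hK4⟩ := hDb N
  have hS := summable_pow_stateSize hr0.le hr1 N
  have pos : ∀ f, 0 < r ^ stateSize N f := fun f => pow_pos hr0 _
  refine Summable.of_norm_bounded ((hS.mul_of_nonneg hS (fun f => by positivity)
    (fun f => by positivity)).mul_left
      (|K1| * |K2| * |K3| * |K4| / (r ^ stateSize N m * r ^ stateSize N n))) ?_
  rintro ⟨k, l⟩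
  by_cases hz : A m k * A' k l * (B n l * D l) = 0
  · rw [hz, norm_zero]
    have := (pos m).le
    have := (pos n).le
    positivity
  have hkl := hA' k l (right_ne_zero_of_mul (left_ne_zero_of_mul hz))
  have hl := hN n l (hN0 N0 le_rfl) (left_ne_zero_of_mul (right_ne_zero_of_mul hz))
  have hk := hkl.tailSum_eq_zero hl
  simp only [hl, hk, if_true]
  have e1 : ‖A m k‖ ≤ |K1| * r ^ stateSize N k / r ^ stateSize N m := by
    rw [le_div_iff₀ (pos m)]
    exact (hK1 m k hk).trans (mul_le_mul_of_nonneg_right (le_abs_self _) (pos k).le)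
  have e2 : ‖A' k l‖ ≤ |K2| * r ^ stateSize N l / r ^ stateSize N k := by
    rw [le_div_iff₀ (pos k)]
    exact (hK2 k l hl).trans (mul_le_mul_of_nonneg_right (le_abs_self _) (pos l).le)
  have e3 : ‖B n l‖ ≤ |K3| * r ^ stateSize N l / r ^ stateSize N n := by
    rw [le_div_iff₀ (pos n)]
    exact (hK3 n l hl).trans (mul_le_mul_of_nonneg_right (le_abs_self _) (pos l).le)
  have e4 : ‖D l‖ ≤ |K4| := (hK4 l hl).trans (le_abs_self _)
  have e5 : r ^ stateSize N l ≤ r ^ stateSize N k :=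
    pow_le_pow_of_le_one hr0.le hr1.le (stateSize_mono hkl)
  have pm := pos m
  have pn := pos n
  have pk := pos k
  have pl := pos l
  rw [norm_mul, norm_mul, norm_mul]
  calc ‖A m k‖ * ‖A' k l‖ * (‖B n l‖ * ‖D l‖)
      ≤ |K1| * r ^ stateSize N k / r ^ stateSize N m *
        (|K2| * r ^ stateSize N l / r ^ stateSize N k) *
        (|K3| * r ^ stateSize N l / r ^ stateSize N n * |K4|) := by gcongr
    _ = |K1| * |K2| * |K3| * |K4| / (r ^ stateSize N m * r ^ stateSize N n) *
        (r ^ stateSize N l * r ^ stateSize N l) := by field_simp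
    _ ≤ _ := by gcongr

/-- Skew Cauchy identities can be composed: the kernel `B` is exchanged first with `A'`, then with
`A`.  The bounds on the kernels justify the change of the order of summation. -/
theorem SkewCauchy.comp {D : (ℕ →₀ ℕ) → ℂ} {A A' B : (ℕ →₀ ℕ) → (ℕ →₀ ℕ) → ℂ} {C C' : ℂ}
    (hD : ∀ f, D f ≠ 0) (hDb : ∀ N, ∃ K : ℝ, ∀ f, tailSum f N = 0 → ‖D f‖ ≤ K)
    (hA' : Increasing A') (hB : Increasing B) (hBn : Narrow B)
    (tA : Tame A) (tA' : Tame A') (tB : Tame B)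
    (h : SkewCauchy D A B C) (h' : SkewCauchy D A' B C') :
    SkewCauchy D (kernelComp A A') B (C * C') := by
  intro m n
  obtain ⟨S, hS⟩ := summable_comp_mul hDb hA' hBn tA tA' tB m n
  have hS' : HasSum (fun p : (ℕ →₀ ℕ) × (ℕ →₀ ℕ) => A m p.2 * A' p.2 p.1 * (B n p.1 * D p.1)) S :=
    (Equiv.prodComm (ℕ →₀ ℕ) (ℕ →₀ ℕ)).hasSum_iff.2 hS
  -- Summation over the intermediate state first gives the left-hand side.
  have h1 : HasSum (fun l => kernelComp A A' m l * B n l * D l) S := by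
    refine hS'.prod_fiberwise fun l => ?_
    have h2 : HasSum (fun k => A m k * A' k l) (kernelComp A A' m l) :=
      (summable_of_hasFiniteSupport ((finite_setOf_stateLE l).subset fun k hk =>
        hA' _ _ (right_ne_zero_of_mul hk))).hasSum
    have h3 := h2.mul_right (B n l * D l)
    rw [← mul_assoc] at h3
    exact h3
  -- Summation over the upper state first allows for the exchange of the rows.
  have h2 : HasSum (fun k => ∑ j ∈ below n, C' * (A' j n * (D n / D j)) *
      (A m k * B j k * D k)) S := by
    refine hS.prod_fiberwise fun k => ?_
    have h3 := (h' k n).mul_left (A m k)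
    have h4 : ∑' j, A' j n * B j k * (D k * D n / D j) =
        ∑ j ∈ below n, A' j n * B j k * (D k * D n / D j) := tsum_eq_sum fun j hj => by
      by_contra hne
      exact hj (mem_below.2 (hA' _ _ (left_ne_zero_of_mul (left_ne_zero_of_mul hne))))
    rw [h4, Finset.mul_sum, Finset.mul_sum] at h3
    have h5 : ∑ j ∈ below n, C' * (A' j n * (D n / D j)) * (A m k * B j k * D k) =
        ∑ j ∈ below n, A m k * (C' * (A' j n * B j k * (D k * D n / D j))) :=
      Finset.sum_congr rfl fun j _ => by ring
    rw [h5]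
    exact h3.congr_fun fun l => by ring
  have h3 : HasSum (fun k => ∑ j ∈ below n, C' * (A' j n * (D n / D j)) *
      (A m k * B j k * D k)) (∑ j ∈ below n, C' * (A' j n * (D n / D j)) *
        (C * ∑' i, A i j * B i m * (D m * D j / D i))) :=
    hasSum_sum fun j _ => (h m j).mul_left _
  convert h1 using 1
  rw [h2.unique h3, tsum_eq_sum (s := below m) fun j hj => by
      by_contra hne
      exact hj (mem_below.2 (hB _ _ (right_ne_zero_of_mul (left_ne_zero_of_mul hne)))),
    Finset.mul_sum]
  have h4 : ∀ j, ∑' i, A i j * B i m * (D m * D j / D i) =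
      ∑ i ∈ below m, A i j * B i m * (D m * D j / D i) := fun j =>
    tsum_eq_sum fun i hi => by
      by_contra hne
      exact hi (mem_below.2 (hB _ _ (right_ne_zero_of_mul (left_ne_zero_of_mul hne))))
  simp only [h4, kernelComp_eq_sum hA', Finset.mul_sum, Finset.sum_mul]
  rw [Finset.sum_comm]
  refine Finset.sum_congr rfl fun j _ => Finset.sum_congr rfl fun i _ => ?_
  have := hD j
  have := hD i
  field_simp

/-! ### Estimates for rows -/

theorem prod_one_add_pow_le {r : ℝ} (h0 : 0 ≤ r) (h1 : r < 1) (n : ℕ) :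
    ∏ i ∈ Finset.range n, (1 + r ^ i) ≤ Real.exp (1 - r)⁻¹ := by
  calc ∏ i ∈ Finset.range n, (1 + r ^ i) ≤ ∏ i ∈ Finset.range n, Real.exp (r ^ i) := by
        refine Finset.prod_le_prod (fun i _ => by positivity) fun i _ => ?_
        rw [add_comm]
        exact Real.add_one_le_exp _
    _ = Real.exp (∑ i ∈ Finset.range n, r ^ i) := (Real.exp_sum _ _).symm
    _ ≤ _ := by
        refine Real.exp_le_exp.2 ?_
        rw [← tsum_geometric_of_lt_one h0 h1]
        exact (summable_geometric_of_lt_one h0 h1).sum_le_tsum _ fun i _ => by positivity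

theorem norm_qPoch_le {r : ℝ} (h0 : 0 ≤ r) (h1 : r < 1) {q a : ℂ} (hq : ‖q‖ ≤ r) (ha : ‖a‖ ≤ 1)
    (n : ℕ) : ‖qPoch q a n‖ ≤ Real.exp (1 - r)⁻¹ := by
  refine le_trans ?_ (prod_one_add_pow_le h0 h1 n)
  rw [qPoch, norm_prod]
  refine Finset.prod_le_prod (fun i _ => norm_nonneg _) fun i _ => ?_
  refine (norm_sub_le _ _).trans ?_
  rw [norm_one, norm_mul, norm_pow]
  have : ‖a‖ * ‖q‖ ^ i ≤ 1 * r ^ i := by gcongr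
  linarith

theorem norm_numer_le {r : ℝ} (h0 : 0 ≤ r) (h1 : r < 1) {q s x : ℂ} (hq : ‖q‖ ≤ r)
    (hs : ‖s‖ ≤ r) (hx : ‖x‖ ≤ r) (l : ℕ) :
    ‖numer q s x l‖ ≤ Real.exp (1 - r)⁻¹ * r ^ l := by
  have h2 : ‖numer q s x l‖ ≤ ∏ i ∈ Finset.range l, (1 + r ^ i) * r := by
    rw [numer, norm_prod]
    refine Finset.prod_le_prod (fun i _ => norm_nonneg _) fun i _ => ?_
    refine (norm_add_le _ _).trans ?_
    rw [norm_mul, norm_pow]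
    have : ‖s‖ * ‖q‖ ^ i ≤ r * r ^ i := by gcongr
    linarith
  rw [Finset.prod_mul_distrib, Finset.prod_const, Finset.card_range] at h2
  exact h2.trans (mul_le_mul_of_nonneg_right (prod_one_add_pow_le h0 h1 l) (pow_nonneg h0 l))

/-- For `|q|, |a| ≤ r` the absolute value of `(a; q)_n` is at least `(r; r)_n`. -/
theorem exists_norm_inv_qPoch_le {r : ℝ} (h0 : 0 ≤ r) (h1 : r < 1) :
    ∃ G : ℝ, 1 ≤ G ∧ ∀ q a : ℂ, ‖q‖ ≤ r → ‖a‖ ≤ r → ∀ n, ‖(qPoch q a n)⁻¹‖ ≤ G := by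
  have hr : ‖(r : ℂ)‖ < 1 := by rwa [Complex.norm_real, Real.norm_of_nonneg h0]
  have h2 := ((tendsto_qPoch hr (r : ℂ)).inv₀ (qPochInf_ne_zero hr hr)).norm
  obtain ⟨G, hG⟩ := h2.bddAbove_range
  refine ⟨max 1 G, le_max_left _ _, fun q a hq ha n => le_trans ?_
    ((hG ⟨n, rfl⟩).trans (le_max_right _ _))⟩
  have hpos : ∀ i : ℕ, 0 < 1 - r * r ^ i := fun i => by
    have : r * r ^ i ≤ r * 1 := mul_le_mul_of_nonneg_left (pow_le_one₀ h0 h1.le) h0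
    linarith
  simp only [norm_inv]
  have h3 : ‖qPoch (r : ℂ) r n‖ = ∏ i ∈ Finset.range n, (1 - r * r ^ i) := by
    rw [qPoch, norm_prod]
    refine Finset.prod_congr rfl fun i _ => ?_
    rw [show (1 : ℂ) - r * (r : ℂ) ^ i = ((1 - r * r ^ i : ℝ) : ℂ) by push_cast; ring,
      Complex.norm_real, Real.norm_of_nonneg (hpos i).le]
  rw [h3]
  refine inv_anti₀ (Finset.prod_pos fun i _ => hpos i) ?_
  rw [qPoch, norm_prod]
  refine Finset.prod_le_prod (fun i _ => (hpos i).le) fun i _ => ?_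
  have h4 := norm_sub_norm_le (1 : ℂ) (a * q ^ i)
  rw [norm_one, norm_mul, norm_pow] at h4
  have : ‖a‖ * ‖q‖ ^ i ≤ r * r ^ i := by gcongr
  linarith

/-- The local weights are bounded, uniformly in the parameters, by a power of `r` for each path
moving to the right. -/
theorem exists_weight_bound {r : ℝ} (h0 : 0 ≤ r) (h1 : r < 1) :
    ∃ K : ℝ, 1 ≤ K ∧ ∀ q s x : ℂ, ‖q‖ ≤ r → ‖s‖ ≤ r → ‖x‖ ≤ r →
      (∀ i j k l, ‖vertexWeight q s x i j k l‖ ≤ K * r ^ l) ∧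
      (∀ l, ‖boundaryWeight q s x l‖ ≤ K * r ^ l) ∧
      ∀ k, ‖qPoch q (s ^ 2) k / qPoch q q k‖ ≤ K := by
  obtain ⟨G, hG1, hG⟩ := exists_norm_inv_qPoch_le h0 h1
  set E := Real.exp (1 - r)⁻¹ with hE
  have hE1 : 1 ≤ E := Real.one_le_exp (inv_nonneg.2 (by linarith))
  have hE0 : 0 < E := by linarith
  have hG0 : 0 < G := by linarith
  have hEG : 1 ≤ E * G := one_le_mul_of_one_le_of_one_le hE1 hG1
  refine ⟨(E * G) ^ 3, one_le_pow₀ hEG, fun q s x hq hs hx => ?_⟩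
  have hs2 : ‖s ^ 2‖ ≤ r := by
    rw [norm_pow, pow_two]
    nlinarith [norm_nonneg s]
  have hsx : ‖-s * x‖ ≤ 1 := by
    rw [norm_mul, norm_neg]
    nlinarith [norm_nonneg s, norm_nonneg x]
  have bq := hG q q hq hq
  have bs := hG q (s ^ 2) hq hs2
  have bn := norm_numer_le h0 h1 hq hs hx
  have bx := norm_qPoch_le h0 h1 hq hsx
  have bq' := norm_qPoch_le h0 h1 hq (hq.trans h1.le)
  have bs' := norm_qPoch_le h0 h1 hq (hs2.trans h1.le)
  have hle1 : E * G ≤ (E * G) ^ 3 := le_self_pow₀ hEG (by norm_num)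
  refine ⟨fun i j k l => ?_, fun l => ?_, fun k => ?_⟩
  · rw [vertexWeight]
    split_ifs
    · rw [div_eq_mul_inv, mul_inv, mul_inv, norm_mul, norm_mul, norm_mul, norm_mul, norm_mul]
      calc _ ≤ E * r ^ l * E * E * (G * G * G) := by
            gcongr
            · exact bn l
            · exact bx _
            · exact bq' k
            · exact bq l
            · exact bq _
            · exact bs k
        _ = _ := by ring
    · rw [norm_zero]
      positivity
  · rw [boundaryWeight, div_eq_mul_inv, norm_mul]
    calc _ ≤ E * r ^ l * G := by
          gcongr
          · exact bn l
          · exact bq l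
      _ = E * G * r ^ l := by ring
      _ ≤ _ := by gcongr
  · rw [div_eq_mul_inv, norm_mul]
    refine le_trans ?_ hle1
    gcongr
    · exact bs' k
    · exact bq k

theorem tailSum_anti_zero {f : ℕ →₀ ℕ} {N c : ℕ} (h : tailSum f N = 0) (hc : N ≤ c) :
    tailSum f c = 0 := by
  have := tailSum_anti f hc
  omega

theorem apply_eq_zero {f : ℕ →₀ ℕ} {N c : ℕ} (h : tailSum f N = 0) (hc : N ≤ c) : f c = 0 := by
  have h1 := tailSum_anti_zero h hc
  rw [tailSum_succ] at h1
  omega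

theorem rowWeight_eq_prod {w : ℕ → ℕ → ℕ → ℕ → ℂ} (hw : w 0 0 0 0 = 1) {N : ℕ} {b t : ℕ →₀ ℕ}
    (hb : tailSum b N = 0) (ht : tailSum t N = 0) (a : ℕ) :
    rowWeight w a b t = if a + tailSum b 0 = tailSum t 0 then ∏ c ∈ Finset.range N,
      w (b c) (tailSum t c - tailSum b c) (t c) (tailSum t (c + 1) - tailSum b (c + 1)) else 0 := by
  rw [rowWeight]
  split_ifs
  · refine finprod_eq_prod_of_mulSupport_subset _ fun c hc => ?_
    rw [Finset.coe_range, Set.mem_Iio]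
    by_contra hlt
    refine hc ?_
    have hN := not_lt.1 hlt
    change w (b c) (tailSum t c - tailSum b c) (t c) (tailSum t (c + 1) - tailSum b (c + 1)) = 1
    rw [apply_eq_zero hb hN, apply_eq_zero ht hN, tailSum_anti_zero ht hN,
      tailSum_anti_zero ht (hN.trans (Nat.le_succ c)), Nat.zero_sub, Nat.zero_sub, hw]
  · rfl

/-- Bounds for the vertices of a row give a bound for the row. -/
theorem norm_fullRow_le {w : ℕ → ℕ → ℕ → ℕ → ℂ} (hw : Admissible w) {β : ℕ → ℂ} {r K : ℝ}
    (h0 : 0 ≤ r) (hK : 0 ≤ K) (bw : ∀ i j k l, ‖w i j k l‖ ≤ K * r ^ l)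
    (bβ : ∀ l, ‖β l‖ ≤ K * r ^ l) {N : ℕ} {m l : ℕ →₀ ℕ} (hl : tailSum l N = 0) :
    ‖fullRow w β m l‖ * r ^ stateSize N m ≤ K ^ (N + 1) * r ^ stateSize N l := by
  by_cases hz : fullRow w β m l = 0
  · rw [hz, norm_zero, zero_mul]
    positivity
  have hle := stateLE_of_fullRow_ne_zero hw hz
  have h1 : ‖fullRow w β m l‖ ≤ K ^ (N + 1) * r ^ tailSum (diffState N l m) 0 := by
    rw [fullRow, rowWeight_eq_prod hw.zero (hle.tailSum_eq_zero hl) hl, if_pos (by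
      have := hle 0
      omega), norm_mul, norm_prod]
    have e1 : tailSum (diffState N l m) 0 =
        ∑ c ∈ Finset.range (N + 1), (tailSum l c - tailSum m c) := by
      rw [Finset.sum_range_succ, hl, Nat.zero_sub, add_zero, tailSum_zero_eq _ N,
        tailSum_diffState, add_zero]
      refine Finset.sum_congr rfl fun c hc => ?_
      rw [diffState, Finsupp.onFinset_apply, if_pos (Finset.mem_range.1 hc)]
    rw [e1, Finset.sum_range_succ', pow_add r, pow_succ K, ← Finset.prod_pow_eq_pow_sum]
    calc _ ≤ (K * r ^ (tailSum l 0 - tailSum m 0)) *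
          ∏ c ∈ Finset.range N, (K * r ^ (tailSum l (c + 1) - tailSum m (c + 1))) := by
          refine mul_le_mul (bβ _) (Finset.prod_le_prod (fun _ _ => norm_nonneg _)
            fun c _ => bw _ _ _ _) (Finset.prod_nonneg fun _ _ => norm_nonneg _) (by positivity)
      _ = _ := by
          rw [Finset.prod_mul_distrib, Finset.prod_const, Finset.card_range]
          ring
  calc ‖fullRow w β m l‖ * r ^ stateSize N m
      ≤ K ^ (N + 1) * r ^ tailSum (diffState N l m) 0 * r ^ stateSize N m := by gcongr
    _ = _ := by rw [mul_assoc, ← pow_add, tailSum_diffState_zero hle]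

theorem increasing_whittakerRow (q s x : ℂ) : Increasing (whittakerRow q s x) := fun _ _ h =>
  stateLE_of_fullRow_ne_zero (admissible_vertexWeight q s x) h

theorem narrow_whittakerRow (q s x : ℂ) : Narrow (whittakerRow q s x) := fun N =>
  ⟨N + 1, fun m l hm h => by
    have := interlacing_of_rowWeight_ne_zero (admissible_vertexWeight q s x)
      (fun {i j k l} h => by
        by_contra h2
        exact h (if_neg fun h3 => h2 h3.2)) (right_ne_zero_of_mul h) N
    omega⟩

theorem tame_whittakerRow {q s x : ℂ} (hq : ‖q‖ < 1) (hs : ‖s‖ < 1) (hx : ‖x‖ < 1) :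
    Tame (whittakerRow q s x) := by
  refine ⟨max (max ‖q‖ ‖s‖) ‖x‖, by simp [hq, hs, hx], fun r h1 h2 N => ?_⟩
  simp only [max_lt_iff] at h1
  have h0 : 0 ≤ r := (norm_nonneg q).trans h1.1.1.le
  obtain ⟨K, hK, hb⟩ := exists_weight_bound h0 h2
  obtain ⟨b1, b2, -⟩ := hb q s x h1.1.1.le h1.1.2.le h1.2.le
  exact ⟨K ^ (N + 1), fun m l hl => norm_fullRow_le (admissible_vertexWeight q s x) h0
    (by linarith) b1 b2 hl⟩

theorem norm_stripWeight_le {q s x : ℂ} (hq : ‖q‖ ≤ 1) (hs : ‖s‖ ≤ 1) (hx : ‖x‖ ≤ 1)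
    (i j k l : ℕ) : ‖stripWeight q s x i j k l‖ ≤ 2 / ‖1 + s * x‖ := by
  have hp : ∀ n, ‖q ^ n‖ ≤ 1 := fun n => by
    rw [norm_pow]
    exact pow_le_one₀ (norm_nonneg _) hq
  have h2 : ∀ a b : ℂ, ‖a‖ ≤ 1 → ‖b‖ ≤ 1 → ‖a * b‖ ≤ 1 := fun a b ha hb => by
    rw [norm_mul]
    exact mul_le_one₀ ha (norm_nonneg _) hb
  have hadd : ∀ a b : ℂ, ‖a‖ ≤ 1 → ‖b‖ ≤ 1 → ‖a + b‖ ≤ 2 := fun a b ha hb =>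
    (norm_add_le a b).trans (by linarith)
  have hsub : ∀ a b : ℂ, ‖a‖ ≤ 1 → ‖b‖ ≤ 1 → ‖a - b‖ ≤ 2 := fun a b ha hb =>
    (norm_sub_le a b).trans (by linarith)
  have h0 : (0 : ℝ) ≤ 2 / ‖1 + s * x‖ := by positivity
  rcases j with _ | _ | j <;> rcases l with _ | _ | l <;> simp only [stripWeight, norm_zero, h0]
  · split_ifs
    · rw [norm_div]
      gcongr
      exact hadd _ _ (by simp) (h2 _ _ (h2 _ _ hs hx) (hp _))
    · simpa using h0
  · split_ifs
    · rw [norm_div, norm_mul, norm_neg]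
      gcongr
      have h3 := hsub 1 (s ^ 2 * q ^ k) (by simp) (h2 _ _ (by
        rw [pow_two]
        exact h2 _ _ hs hs) (hp _))
      nlinarith [norm_nonneg x, norm_nonneg (1 - s ^ 2 * q ^ k)]
    · simpa using h0
  · split_ifs
    · rw [norm_div]
      gcongr
      exact hsub _ _ (by simp) (hp _)
    · simpa using h0
  · split_ifs
    · rw [norm_div, norm_neg]
      gcongr
      exact hadd _ _ hx (h2 _ _ hs (hp _))
    · simpa using h0

theorem tame_stripRow {q s x : ℂ} (hq : ‖q‖ ≤ 1) (hs : ‖s‖ ≤ 1) (hx : ‖x‖ ≤ 1)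
    (h : 1 + s * x ≠ 0) : Tame (stripRow q s x) := by
  refine ⟨0, one_pos, fun r h0 h1 N => ?_⟩
  -- Each horizontal edge carries at most one path, so that a power of `r` costs a constant.
  set K := max (2 / ‖1 + s * x‖) 1 / r with hKdef
  have hK1 : 2 / ‖1 + s * x‖ ≤ K * r := by
    rw [hKdef, div_mul_cancel₀ _ h0.ne']
    exact le_max_left _ _
  have hK2 : 1 ≤ K * r := by
    rw [hKdef, div_mul_cancel₀ _ h0.ne']
    exact le_max_right _ _
  have hK0 : 0 ≤ K := by positivity
  have hpow : ∀ l : ℕ, l ≤ 1 → K * r ≤ K * r ^ l := fun l hl => by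
    interval_cases l
    · rw [pow_zero]
      gcongr
    · rw [pow_one]
  refine ⟨K ^ (N + 1), fun m l hl => norm_fullRow_le (admissible_stripWeight h) h0.le hK0
    (fun i j k l => ?_) (fun l => ?_) hl⟩
  · by_cases hz : stripWeight q s x i j k l = 0
    · rw [hz, norm_zero]
      positivity
    · exact ((norm_stripWeight_le hq hs hx i j k l).trans hK1).trans
        (hpow l (stripWeight_le_one hz).2)
  · rcases l with _ | _ | l
    · simpa [stripBoundary] using hK2.trans (hpow 0 (by omega))
    · simpa [stripBoundary] using hx.trans hK2
    · simp only [stripBoundary, norm_zero]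
      positivity

/-! ### The dual weights -/

/-- The product of `(s²; q)_k / (q; q)_k` over the columns, `k` being the occupation number. -/
def stateFactor (q s : ℂ) (f : ℕ →₀ ℕ) : ℂ := ∏ᶠ c, qPoch q (s ^ 2) (f c) / qPoch q q (f c)

theorem stateFactor_eq_prod (q s : ℂ) {f : ℕ →₀ ℕ} {N : ℕ} (h : tailSum f N = 0) :
    stateFactor q s f = ∏ c ∈ Finset.range N, qPoch q (s ^ 2) (f c) / qPoch q q (f c) := by
  refine finprod_eq_prod_of_mulSupport_subset _ fun c hc => ?_
  rw [Finset.coe_range, Set.mem_Iio]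
  by_contra hlt
  refine hc ?_
  change qPoch q (s ^ 2) (f c) / qPoch q q (f c) = 1
  rw [apply_eq_zero h (not_lt.1 hlt), qPoch_zero, qPoch_zero, div_one]

theorem stateFactor_ne_zero {q s : ℂ} (hr : Regular q s) (f : ℕ →₀ ℕ) : stateFactor q s f ≠ 0 := by
  obtain ⟨N, hN⟩ := exists_tailSum_eq_zero f
  rw [stateFactor_eq_prod q s (hN N le_rfl)]
  exact Finset.prod_ne_zero_iff.2 fun c _ => div_ne_zero (hr.s_ne _) (hr.q_ne _)

theorem dualVertexWeight_mul {q s : ℂ} (hr : Regular q s) (y : ℂ) {i j k l : ℕ} :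
    dualVertexWeight q s y i j k l * (qPoch q (s ^ 2) i / qPoch q q i) =
      vertexWeight q s y i j k l * (qPoch q (s ^ 2) k / qPoch q q k) := by
  rw [dualVertexWeight, dualFactorWeight, vertexWeight]
  have h1 := hr.q_ne i
  have h2 := hr.s_ne i
  have h3 := hr.q_ne k
  have h4 := hr.s_ne k
  by_cases h : i + j = k + l
  · by_cases h' : l ≤ i
    · rw [if_pos h, if_pos h', if_pos ⟨h, h'⟩]
      field_simp
    · rw [if_pos h, if_neg h', if_neg fun h2 => h' h2.2]
      ring
  · rw [if_neg h, if_neg fun h2 => h h2.1]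
    ring

/-- Conjugation of the local weights amounts to conjugation of the row by `stateFactor`. -/
theorem dualRow_mul {q s : ℂ} (hr : Regular q s) (y : ℂ) (m l : ℕ →₀ ℕ) :
    dualRow q s y m l * stateFactor q s m = whittakerRow q s y m l * stateFactor q s l := by
  obtain ⟨N1, h1⟩ := exists_tailSum_eq_zero m
  obtain ⟨N2, h2⟩ := exists_tailSum_eq_zero l
  have hm := h1 (N1 + N2) (by omega)
  have hl := h2 (N1 + N2) (by omega)
  rw [dualRow, whittakerRow, fullRow, fullRow,
    rowWeight_eq_prod (admissible_dualVertexWeight q s y).zero hm hl,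
    rowWeight_eq_prod (admissible_vertexWeight q s y).zero hm hl, stateFactor_eq_prod q s hm,
    stateFactor_eq_prod q s hl, mul_assoc, mul_assoc]
  congr 1
  split_ifs
  · rw [← Finset.prod_mul_distrib, ← Finset.prod_mul_distrib]
    exact Finset.prod_congr rfl fun c _ => dualVertexWeight_mul hr y
  · ring

theorem norm_stateFactor_le {q s : ℂ} (hq : ‖q‖ < 1) (hs : ‖s‖ < 1) (N : ℕ) :
    ∃ K : ℝ, ∀ f, tailSum f N = 0 → ‖stateFactor q s f‖ ≤ K := by
  obtain ⟨K, hK, hb⟩ := exists_weight_bound (r := max ‖q‖ ‖s‖)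
    ((norm_nonneg q).trans (le_max_left _ _)) (max_lt hq hs)
  refine ⟨K ^ N, fun f hf => ?_⟩
  rw [stateFactor_eq_prod q s hf, norm_prod, ← Finset.card_range N, ← Finset.prod_const,
    Finset.card_range]
  exact Finset.prod_le_prod (fun _ _ => norm_nonneg _) fun c _ =>
    (hb q s 0 (le_max_left _ _) (le_max_right _ _) (by simp)).2.2 _

/-! ### The identity for one variable, at special values -/

theorem one_add_mul_ne_zero {s x : ℂ} (hs : ‖s‖ < 1) (hx : ‖x‖ < 1) : 1 + s * x ≠ 0 := by
  intro h
  have h1 : ‖s * x‖ < 1 := by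
    rw [norm_mul]
    nlinarith [norm_nonneg s, norm_nonneg x]
  rw [show s * x = -1 by linear_combination h, norm_neg, norm_one] at h1
  exact lt_irrefl _ h1

theorem skewCauchy_stripRow {q s x : ℂ} (hr : Regular q s) (hx : 1 + s * x ≠ 0) (y : ℂ) :
    SkewCauchy (stateFactor q s) (stripRow q s x) (whittakerRow q s y)
      ((1 - x * y) / (1 + s * x)) := by
  intro m n
  have hn := stateFactor_ne_zero hr n
  have e : ∀ l, stripRow q s x m l * whittakerRow q s y n l * stateFactor q s l =
      stripRow q s x m l * dualRow q s y n l * stateFactor q s n := fun l => by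
    linear_combination -stripRow q s x m l * dualRow_mul hr y n l
  have e' : ∀ k, stripRow q s x k n * whittakerRow q s y k m *
      (stateFactor q s m * stateFactor q s n / stateFactor q s k) =
      stripRow q s x k n * dualRow q s y k m * stateFactor q s n := fun k => by
    have hk := stateFactor_ne_zero hr k
    field_simp
    linear_combination -stripRow q s x k n * dualRow_mul hr y k m
  simp only [e, e', tsum_mul_right]
  rw [← mul_assoc, ← stripRow_dualRow_exchange hr hx y m n]
  refine (summable_of_hasFiniteSupport ((((finite_support_pairAbove
    (admissible_dualVertexWeight q s y) (fun h => dualVertexWeight_le h) (w := stripWeight q s x)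
      0 (tailSum m 0 - tailSum n 0) m n)).union (finite_support_pairAbove
    (admissible_dualVertexWeight q s y) (fun h => dualVertexWeight_le h) (w := stripWeight q s x)
      1 (1 + tailSum m 0 - tailSum n 0) m n)).subset fun l hl => ?_)).hasSum.mul_right _
  rw [Function.mem_support, stripRow_eq_add, add_mul, mul_assoc, dualRow,
    rowWeight_mul_fullRow_above, rowWeight_mul_fullRow_above, Nat.zero_add] at hl
  by_contra h
  simp only [Set.mem_union, Function.mem_support, not_or, not_not] at h
  exact hl (by rw [h.1, h.2]; ring)

theorem kernelComp_stripRow {q s x : ℂ} (hr : Regular q s) (hx : 1 + s * x ≠ 0) :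
    kernelComp (stripRow q s x) (whittakerRow q s x) = whittakerRow q s (q * x) :=
  funext fun m => funext fun l => tsum_stripRow_mul_whittakerRow hr hx m l

/-- The skew Cauchy identity at the points `x = -s * q ^ J`, by adding `J` strip rows to the
identity kernel. -/
theorem skewCauchy_special {q s y : ℂ} (hq : ‖q‖ < 1) (hs : ‖s‖ < 1) (hy : ‖y‖ < 1) (J : ℕ) :
    SkewCauchy (stateFactor q s) (whittakerRow q s (-s * q ^ J)) (whittakerRow q s y)
      (qPoch q (-s * y) J / qPoch q (s ^ 2) J) := by
  have hr := regular_of_norm_lt_one hq hs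
  induction J with
  | zero =>
    have h : whittakerRow q s (-s * q ^ 0) = idKernel := by
      ext m l
      rw [pow_zero, mul_one, whittakerRow_neg hr, idKernel]
    rw [h, qPoch_zero, qPoch_zero, div_one]
    exact SkewCauchy.of_id (stateFactor_ne_zero hr) _
  | succ J ih =>
    have hx : ‖-s * q ^ J‖ < 1 := by
      rw [norm_mul, norm_neg, norm_pow]
      calc ‖s‖ * ‖q‖ ^ J ≤ ‖s‖ * 1 :=
            mul_le_mul_of_nonneg_left (pow_le_one₀ (norm_nonneg _) hq.le) (norm_nonneg _)
        _ < 1 := by linarith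
    have hx0 := one_add_mul_ne_zero hs hx
    have h := SkewCauchy.comp (stateFactor_ne_zero hr) (norm_stateFactor_le hq hs)
      (increasing_whittakerRow q s _) (increasing_whittakerRow q s y) (narrow_whittakerRow q s y)
      (tame_stripRow hq.le hs.le hx.le hx0) (tame_whittakerRow hq hs hx)
      (tame_whittakerRow hq hs hy) (skewCauchy_stripRow hr hx0 y) ih
    rw [kernelComp_stripRow hr hx0, show q * (-s * q ^ J) = -s * q ^ (J + 1) by ring] at h
    convert h using 1
    have h1 := hr.s_ne J
    have h2 := hr.s_pow J
    rw [show 1 + s * (-s * q ^ J) = 1 - s ^ 2 * q ^ J by ring, qPoch_succ, qPoch_succ]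
    field_simp

/-! ### The identity for one variable -/

theorem differentiableOn_qPoch {U : Set ℂ} {q a : ℂ → ℂ} (hq : DifferentiableOn ℂ q U)
    (ha : DifferentiableOn ℂ a U) (n : ℕ) : DifferentiableOn ℂ (fun z => qPoch (q z) (a z) n) U := by
  unfold qPoch
  fun_prop

theorem differentiableOn_numer {U : Set ℂ} {q s x : ℂ → ℂ} (hq : DifferentiableOn ℂ q U)
    (hs : DifferentiableOn ℂ s U) (hx : DifferentiableOn ℂ x U) (n : ℕ) :
    DifferentiableOn ℂ (fun z => numer (q z) (s z) (x z) n) U := by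
  unfold numer
  fun_prop

theorem differentiableOn_qPochInf {U : Set ℂ} (hU : IsOpen U) {q a : ℂ → ℂ}
    (hq : DifferentiableOn ℂ q U) (ha : DifferentiableOn ℂ a U) {r : ℝ} (h0 : 0 ≤ r) (h1 : r < 1)
    (bq : ∀ z ∈ U, ‖q z‖ ≤ r) (ba : ∀ z ∈ U, ‖a z‖ ≤ 1) :
    DifferentiableOn ℂ (fun z => qPochInf (q z) (a z)) U := by
  have hc : HasProdLocallyUniformlyOn (fun (n : ℕ) z => 1 + -(a z * q z ^ n))
      (fun z => ∏' n : ℕ, (1 + -(a z * q z ^ n))) U := by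
    refine hasProdLocallyUniformlyOn_of_forall_compact hU fun K hK hcK => ?_
    have hq' := hq.continuousOn.mono hK
    have ha' := ha.continuousOn.mono hK
    refine (summable_geometric_of_lt_one h0 h1).hasProdUniformlyOn_nat_one_add hcK
      (.of_forall fun n z hz => ?_) (fun n => by fun_prop)
    rw [norm_neg, norm_mul, norm_pow]
    calc ‖a z‖ * ‖q z‖ ^ n ≤ 1 * r ^ n :=
          mul_le_mul (ba z (hK hz)) (pow_le_pow_left₀ (norm_nonneg _) (bq z (hK hz)) n)
            (by positivity) zero_le_one
      _ = r ^ n := one_mul _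
  have h2 := hc.differentiableOn (.of_forall fun s => by
    simpa [Finset.prod_fn] using DifferentiableOn.finsetProd (fun i _ => by fun_prop)) hU
  simpa only [qPochInf, sub_eq_add_neg] using h2

/-- The constant of the skew Cauchy identity for one variable on each side. -/
def cauchyConst (q s x y : ℂ) : ℂ :=
  qPochInf q (-s * x) * qPochInf q (-s * y) / (qPochInf q (s ^ 2) * qPochInf q (x * y))

section

variable {U : Set ℂ} {q s x y : ℂ → ℂ} {r : ℝ}

theorem differentiableOn_whittakerRow (hq : DifferentiableOn ℂ q U) (hs : DifferentiableOn ℂ s U)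
    (hx : DifferentiableOn ℂ x U) (h1 : r < 1) (bq : ∀ z ∈ U, ‖q z‖ ≤ r)
    (bs : ∀ z ∈ U, ‖s z‖ ≤ r) (m l : ℕ →₀ ℕ) :
    DifferentiableOn ℂ (fun z => whittakerRow (q z) (s z) (x z) m l) U := by
  obtain ⟨N1, hN1⟩ := exists_tailSum_eq_zero m
  obtain ⟨N2, hN2⟩ := exists_tailSum_eq_zero l
  have hreg : ∀ z ∈ U, Regular (q z) (s z) := fun z hz =>
    regular_of_norm_lt_one ((bq z hz).trans_lt h1) ((bs z hz).trans_lt h1)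
  have hw : ∀ z, rowWeight (vertexWeight (q z) (s z) (x z)) (tailSum l 0 - tailSum m 0) m l = _ :=
    fun z => rowWeight_eq_prod (vertexWeight_zero (q z) (s z) (x z)) (hN1 (N1 + N2) (by omega))
      (hN2 (N1 + N2) (by omega)) _
  have hqq : ∀ n, DifferentiableOn ℂ (fun z => qPoch (q z) (q z) n) U :=
    differentiableOn_qPoch hq hq
  have hqs : ∀ n, DifferentiableOn ℂ (fun z => qPoch (q z) (s z ^ 2) n) U :=
    differentiableOn_qPoch hq (hs.fun_pow 2)
  have hqx : ∀ n, DifferentiableOn ℂ (fun z => qPoch (q z) (-s z * x z) n) U :=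
    differentiableOn_qPoch hq (hs.fun_neg.fun_mul hx)
  have hn := differentiableOn_numer hq hs hx
  simp only [whittakerRow, fullRow, hw]
  refine DifferentiableOn.fun_mul ?_ ?_
  · exact (hn _).fun_div (hqq _) fun z hz => (hreg z hz).q_ne _
  · split_ifs
    · refine DifferentiableOn.fun_finsetProd fun c _ => ?_
      unfold vertexWeight
      split_ifs
      · exact (((hn _).fun_mul (hqx _)).fun_mul (hqq _)).fun_div
          (((hqq _).fun_mul (hqq _)).fun_mul (hqs _)) fun z hz =>
            mul_ne_zero (mul_ne_zero ((hreg z hz).q_ne _) ((hreg z hz).q_ne _)) ((hreg z hz).s_ne _)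
      · exact differentiableOn_const _
    · exact differentiableOn_const _

theorem differentiableOn_stateFactor (hq : DifferentiableOn ℂ q U) (hs : DifferentiableOn ℂ s U)
    (h1 : r < 1) (bq : ∀ z ∈ U, ‖q z‖ ≤ r) (l : ℕ →₀ ℕ) :
    DifferentiableOn ℂ (fun z => stateFactor (q z) (s z) l) U := by
  obtain ⟨N, hN⟩ := exists_tailSum_eq_zero l
  simp only [fun z => stateFactor_eq_prod (q z) (s z) (hN N le_rfl)]
  exact DifferentiableOn.fun_finsetProd fun c _ =>
    (differentiableOn_qPoch hq (hs.fun_pow 2) _).fun_div (differentiableOn_qPoch hq hq _)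
      fun z hz => qPoch_ne_zero ((bq z hz).trans_lt h1) ((bq z hz).trans_lt h1) _

end

/-- The terms of the left-hand side are dominated by a summable family, uniformly in the
parameters. -/
theorem exists_summable_bound {r : ℝ} (h0 : 0 < r) (h1 : r < 1) (m n : ℕ →₀ ℕ) :
    ∃ u : (ℕ →₀ ℕ) → ℝ, Summable u ∧ ∀ q s x y : ℂ, ‖q‖ ≤ r → ‖s‖ ≤ r → ‖x‖ ≤ r → ‖y‖ ≤ r →
      ∀ l, ‖whittakerRow q s x m l * whittakerRow q s y n l * stateFactor q s l‖ ≤ u l := by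
  obtain ⟨K, hK, hb⟩ := exists_weight_bound h0.le h1
  obtain ⟨N0, hN0⟩ := exists_tailSum_eq_zero n
  have hK0 : 0 ≤ K := by linarith
  set N := N0 + 1 with hNdef
  have pos : ∀ f, 0 < r ^ stateSize N f := fun f => pow_pos h0 _
  refine ⟨fun l => K ^ (N + 1) / r ^ stateSize N m * (K ^ (N + 1) / r ^ stateSize N n) * K ^ N *
    if tailSum l N = 0 then r ^ stateSize N l else 0,
    (summable_pow_stateSize h0.le h1 N).mul_left _, fun q s x y hq hs hx hy l => ?_⟩
  have pm := pos m
  have pn := pos n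
  have pl := pos l
  by_cases hz : whittakerRow q s x m l * whittakerRow q s y n l * stateFactor q s l = 0
  · rw [hz, norm_zero]
    positivity
  have hl : tailSum l N = 0 := by
    have h2 := interlacing_of_rowWeight_ne_zero (admissible_vertexWeight q s y)
      (fun {i j k l} h => by
        by_contra h2
        exact h (if_neg fun h3 => h2 h3.2))
      (right_ne_zero_of_mul (right_ne_zero_of_mul (left_ne_zero_of_mul hz))) N0
    rw [hN0 N0 le_rfl] at h2
    exact Nat.le_zero.1 h2
  obtain ⟨b1, b2, b3⟩ := hb q s x hq hs hx
  obtain ⟨b1', b2', -⟩ := hb q s y hq hs hy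
  have e1 : ‖whittakerRow q s x m l‖ ≤ K ^ (N + 1) * r ^ stateSize N l / r ^ stateSize N m := by
    rw [le_div_iff₀ pm]
    exact norm_fullRow_le (admissible_vertexWeight q s x) h0.le hK0 b1 b2 hl
  have e2 : ‖whittakerRow q s y n l‖ ≤ K ^ (N + 1) * r ^ stateSize N l / r ^ stateSize N n := by
    rw [le_div_iff₀ pn]
    exact norm_fullRow_le (admissible_vertexWeight q s y) h0.le hK0 b1' b2' hl
  have e3 : ‖stateFactor q s l‖ ≤ K ^ N := by
    rw [stateFactor_eq_prod q s hl, norm_prod, ← Finset.card_range N, ← Finset.prod_const,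
      Finset.card_range]
    exact Finset.prod_le_prod (fun _ _ => norm_nonneg _) fun c _ => b3 _
  have e4 : r ^ stateSize N l ≤ 1 := pow_le_one₀ h0.le h1.le
  simp only [if_pos hl, norm_mul]
  calc _ ≤ (K ^ (N + 1) * r ^ stateSize N l / r ^ stateSize N m) *
        (K ^ (N + 1) * r ^ stateSize N l / r ^ stateSize N n) * K ^ N := by gcongr
    _ = K ^ (N + 1) / r ^ stateSize N m * (K ^ (N + 1) / r ^ stateSize N n) * K ^ N *
        (r ^ stateSize N l * r ^ stateSize N l) := by ring
    _ ≤ _ := by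
        gcongr
        exact mul_le_of_le_one_left pl.le e4

/-- The difference of the two sides of the skew Cauchy identity for one variable. -/
def cauchyDefect (m n : ℕ →₀ ℕ) (q s x y : ℂ) : ℂ :=
  ∑' l, whittakerRow q s x m l * whittakerRow q s y n l * stateFactor q s l -
    cauchyConst q s x y * ∑ k ∈ below m, whittakerRow q s x k n * whittakerRow q s y k m *
      (stateFactor q s m * stateFactor q s n / stateFactor q s k)

theorem norm_mul_le_one {a b : ℂ} (ha : ‖a‖ ≤ 1) (hb : ‖b‖ ≤ 1) : ‖a * b‖ ≤ 1 := by
  rw [norm_mul]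
  exact mul_le_one₀ ha (norm_nonneg _) hb

theorem norm_mul_lt_one {a b : ℂ} (ha : ‖a‖ < 1) (hb : ‖b‖ < 1) : ‖a * b‖ < 1 := by
  rw [norm_mul]
  exact mul_lt_one_of_nonneg_of_lt_one_left (norm_nonneg _) ha hb.le

/-- Both sides depend holomorphically on all parameters. -/
theorem differentiableOn_cauchyDefect {U : Set ℂ} (hU : IsOpen U) {q s x y : ℂ → ℂ} {r : ℝ}
    (h0 : 0 < r) (h1 : r < 1) (hq : DifferentiableOn ℂ q U) (hs : DifferentiableOn ℂ s U)
    (hx : DifferentiableOn ℂ x U) (hy : DifferentiableOn ℂ y U) (bq : ∀ z ∈ U, ‖q z‖ ≤ r)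
    (bs : ∀ z ∈ U, ‖s z‖ ≤ r) (bx : ∀ z ∈ U, ‖x z‖ ≤ r) (hby : ∀ z ∈ U, ‖y z‖ ≤ r)
    (m n : ℕ →₀ ℕ) : DifferentiableOn ℂ (fun z => cauchyDefect m n (q z) (s z) (x z) (y z)) U := by
  have hW := fun m l => differentiableOn_whittakerRow hq hs hx h1 bq bs m l
  have hW' := fun m l => differentiableOn_whittakerRow hq hs hy h1 bq bs m l
  have hD := fun l => differentiableOn_stateFactor hq hs h1 bq l
  have hle : ∀ {f : ℂ → ℂ}, (∀ z ∈ U, ‖f z‖ ≤ r) → ∀ z ∈ U, ‖f z‖ ≤ 1 :=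
    fun hf z hz => (hf z hz).trans h1.le
  have hlt : ∀ {f : ℂ → ℂ}, (∀ z ∈ U, ‖f z‖ ≤ r) → ∀ z ∈ U, ‖f z‖ < 1 :=
    fun hf z hz => (hf z hz).trans_lt h1
  obtain ⟨u, hu, hb⟩ := exists_summable_bound h0 h1 m n
  unfold cauchyDefect cauchyConst
  refine DifferentiableOn.fun_sub ?_ (DifferentiableOn.fun_mul (DifferentiableOn.fun_div ?_ ?_ ?_)
    (DifferentiableOn.fun_sum fun k _ => ?_))
  · exact Complex.differentiableOn_tsum_of_summable_norm hu
      (fun l => ((hW m l).fun_mul (hW' n l)).fun_mul (hD l)) hU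
      fun l z hz => hb _ _ _ _ (bq z hz) (bs z hz) (bx z hz) (hby z hz) l
  · refine DifferentiableOn.fun_mul
      (differentiableOn_qPochInf hU hq (hs.fun_neg.fun_mul hx) h0.le h1 bq fun z hz => ?_)
      (differentiableOn_qPochInf hU hq (hs.fun_neg.fun_mul hy) h0.le h1 bq fun z hz => ?_)
    · exact norm_mul_le_one (by simpa using hle bs z hz) (hle bx z hz)
    · exact norm_mul_le_one (by simpa using hle bs z hz) (hle hby z hz)
  · refine DifferentiableOn.fun_mul
      (differentiableOn_qPochInf hU hq (hs.fun_pow 2) h0.le h1 bq fun z hz => ?_)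
      (differentiableOn_qPochInf hU hq (hx.fun_mul hy) h0.le h1 bq fun z hz => ?_)
    · exact (norm_sq_lt_one (hlt bs z hz)).le
    · exact norm_mul_le_one (hle bx z hz) (hle hby z hz)
  · intro z hz
    exact mul_ne_zero (qPochInf_ne_zero (hlt bq z hz) (norm_sq_lt_one (hlt bs z hz)))
      (qPochInf_ne_zero (hlt bq z hz) (norm_mul_lt_one (hlt bx z hz) (hlt hby z hz)))
  · exact ((hW k n).fun_mul (hW' k m)).fun_mul (((hD m).fun_mul (hD n)).fun_div (hD k) fun z hz =>
      stateFactor_ne_zero (regular_of_norm_lt_one (hlt bq z hz) (hlt bs z hz)) k)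

theorem qPochInf_eq_mul {q : ℂ} (hq : ‖q‖ < 1) (a : ℂ) (J : ℕ) :
    qPochInf q a = qPoch q a J * qPochInf q (a * q ^ J) := by
  have h1 := (tendsto_qPoch hq (a * q ^ J)).const_mul (qPoch q a J)
  have h2 := (tendsto_qPoch hq a).comp (Filter.tendsto_add_atTop_nat J)
  refine tendsto_nhds_unique h2 (h1.congr fun n => ?_)
  rw [Function.comp_apply, qPoch, qPoch, qPoch, add_comm n J, Finset.prod_range_add]
  congr 1
  refine Finset.prod_congr rfl fun i _ => ?_
  ring

/-- At `x = -s * q ^ J` the infinite products telescope. -/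
theorem cauchyConst_special {q s y : ℂ} (hq : ‖q‖ < 1) (hs : ‖s‖ < 1) (hy : ‖y‖ < 1) (J : ℕ) :
    cauchyConst q s (-s * q ^ J) y = qPoch q (-s * y) J / qPoch q (s ^ 2) J := by
  have hs2 := norm_sq_lt_one hs
  have hsy : ‖-s * y‖ < 1 := norm_mul_lt_one (by rwa [norm_neg]) hy
  have hJ : ‖q ^ J‖ ≤ 1 := by
    rw [norm_pow]
    exact pow_le_one₀ (norm_nonneg _) hq.le
  have h1 : qPochInf q (s ^ 2 * q ^ J) ≠ 0 := qPochInf_ne_zero hq (by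
    rw [norm_mul]
    exact mul_lt_one_of_nonneg_of_lt_one_left (norm_nonneg _) hs2 hJ)
  have h2 : qPochInf q (-s * y * q ^ J) ≠ 0 := qPochInf_ne_zero hq (by
    rw [norm_mul]
    exact mul_lt_one_of_nonneg_of_lt_one_left (norm_nonneg _) hsy hJ)
  have h3 := qPoch_ne_zero hq hs2 J
  rw [cauchyConst, show -s * (-s * q ^ J) = s ^ 2 * q ^ J by ring,
    show -s * q ^ J * y = -s * y * q ^ J by ring, qPochInf_eq_mul hq (-s * y) J,
    qPochInf_eq_mul hq (s ^ 2) J]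
  generalize qPochInf q (-s * y * q ^ J) = u at *
  generalize qPochInf q (s ^ 2 * q ^ J) = v at *
  field_simp

theorem cauchyDefect_special {q s y : ℂ} (hq : ‖q‖ < 1) (hs : ‖s‖ < 1) (hy : ‖y‖ < 1)
    (m n : ℕ →₀ ℕ) (J : ℕ) : cauchyDefect m n q s (-s * q ^ J) y = 0 := by
  have h := (skewCauchy_special hq hs hy J m n).tsum_eq
  rw [cauchyDefect, h, cauchyConst_special hq hs hy, tsum_eq_sum (s := below m), sub_self]
  intro k hk
  by_contra hne
  exact hk (mem_below.2 (increasing_whittakerRow q s y _ _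
    (right_ne_zero_of_mul (left_ne_zero_of_mul hne))))

/-- For nonzero `q` and `s` the points `-s * q ^ J` accumulate at `0`. -/
theorem cauchyDefect_of_ne_zero {q s x y : ℂ} (hq : ‖q‖ < 1) (hs : ‖s‖ < 1) (hx : ‖x‖ < 1)
    (hy : ‖y‖ < 1) (hq0 : q ≠ 0) (hs0 : s ≠ 0) (m n : ℕ →₀ ℕ) : cauchyDefect m n q s x y = 0 := by
  obtain ⟨r, hr, h1⟩ := exists_between
    (show max (max ‖q‖ ‖s‖) (max ‖x‖ ‖y‖) < 1 by simp [hq, hs, hx, hy])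
  simp only [max_lt_iff] at hr
  obtain ⟨⟨rq, rs⟩, rx, ry⟩ := hr
  have h0 : 0 < r := (norm_nonneg q).trans_lt rq
  have hd := differentiableOn_cauchyDefect (U := Metric.ball 0 r) Metric.isOpen_ball
    (q := fun _ => q) (s := fun _ => s) (x := fun z => z) (y := fun _ => y) h0 h1 (by fun_prop)
    (by fun_prop) (by fun_prop) (by fun_prop) (fun _ _ => rq.le) (fun _ _ => rs.le)
    (fun z hz => (mem_ball_zero_iff.1 hz).le) (fun _ _ => ry.le) m n
  refine (hd.analyticOnNhd Metric.isOpen_ball).eqOn_zero_of_preconnected_of_frequently_eq_zero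
    (convex_ball 0 r).isPreconnected (Metric.mem_ball_self h0) ?_ (mem_ball_zero_iff.2 rx)
  have ht : Filter.Tendsto (fun J : ℕ => -s * q ^ J) Filter.atTop (nhdsWithin 0 {0}ᶜ) := by
    refine tendsto_nhdsWithin_iff.2 ⟨?_, .of_forall fun J => ?_⟩
    · simpa using (tendsto_pow_atTop_nhds_zero_of_norm_lt_one hq).const_mul (-s)
    · simp [hq0, hs0]
  exact ht.frequently (.of_forall fun J => cauchyDefect_special hq hs hy m n J)

/-- The excluded values of `q` and `s` are reached by moving along a line. -/
theorem cauchyDefect_eq_zero {q s x y : ℂ} (hq : ‖q‖ < 1) (hs : ‖s‖ < 1) (hx : ‖x‖ < 1)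
    (hy : ‖y‖ < 1) (m n : ℕ →₀ ℕ) : cauchyDefect m n q s x y = 0 := by
  obtain ⟨r, hr, h1⟩ := exists_between
    (show max (max ‖q‖ ‖s‖) (max ‖x‖ ‖y‖) < 1 by simp [hq, hs, hx, hy])
  simp only [max_lt_iff] at hr
  obtain ⟨⟨rq, rs⟩, rx, ry⟩ := hr
  have h0 : 0 < r := (norm_nonneg q).trans_lt rq
  obtain ⟨δ, hδ0, hδ⟩ := exists_between (show 0 < min (r - ‖q‖) (r - ‖s‖) by simp [rq, rs])
  rw [lt_min_iff] at hδ
  -- The direction `1` is used for a parameter that vanishes, and `0` for one that does not.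
  set a : ℂ := if q = 0 then 1 else 0
  set b : ℂ := if s = 0 then 1 else 0
  have ha : ‖a‖ ≤ 1 := by
    simp only [a]
    split_ifs <;> simp
  have hb : ‖b‖ ≤ 1 := by
    simp only [b]
    split_ifs <;> simp
  have bd : ∀ {c d : ℂ}, ‖d‖ ≤ 1 → δ < r - ‖c‖ → ∀ z ∈ Metric.ball (0 : ℂ) δ, ‖c + d * z‖ ≤ r := by
    intro c d hd hc z hz
    rw [mem_ball_zero_iff] at hz
    have h2 := norm_add_le c (d * z)
    rw [norm_mul] at h2
    nlinarith [norm_nonneg z]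
  have hd := differentiableOn_cauchyDefect (U := Metric.ball 0 δ) Metric.isOpen_ball
    (q := fun z => q + a * z) (s := fun z => s + b * z) (x := fun _ => x) (y := fun _ => y) h0 h1
    (by fun_prop) (by fun_prop) (by fun_prop) (by fun_prop) (bd ha hδ.1) (bd hb hδ.2)
    (fun _ _ => rx.le) (fun _ _ => ry.le) m n
  have h := (hd.analyticOnNhd Metric.isOpen_ball).eqOn_zero_of_preconnected_of_frequently_eq_zero
    (convex_ball 0 δ).isPreconnected (Metric.mem_ball_self hδ0) ?_ (Metric.mem_ball_self hδ0)
  · simpa using h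
  · refine Filter.Eventually.frequently ?_
    filter_upwards [self_mem_nhdsWithin,
      nhdsWithin_le_nhds (Metric.ball_mem_nhds (0 : ℂ) hδ0)] with z hz hzb
    have hz0 : z ≠ 0 := hz
    refine cauchyDefect_of_ne_zero ((bd ha hδ.1 z hzb).trans_lt h1)
      ((bd hb hδ.2 z hzb).trans_lt h1) hx hy ?_ ?_ m n
    · by_cases h : q = 0 <;> simp [a, h, hz0]
    · by_cases h : s = 0 <;> simp [b, h, hz0]

theorem skewCauchy_whittakerRow {q s x y : ℂ} (hq : ‖q‖ < 1) (hs : ‖s‖ < 1) (hx : ‖x‖ < 1)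
    (hy : ‖y‖ < 1) : SkewCauchy (stateFactor q s) (whittakerRow q s x) (whittakerRow q s y)
      (cauchyConst q s x y) := by
  intro m n
  obtain ⟨r, hr, h1⟩ := exists_between
    (show max (max ‖q‖ ‖s‖) (max ‖x‖ ‖y‖) < 1 by simp [hq, hs, hx, hy])
  simp only [max_lt_iff] at hr
  obtain ⟨⟨rq, rs⟩, rx, ry⟩ := hr
  obtain ⟨u, hu, hb⟩ := exists_summable_bound ((norm_nonneg q).trans_lt rq) h1 m n
  have h := (hu.of_norm_bounded (hb q s x y rq.le rs.le rx.le ry.le)).hasSum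
  have h2 := sub_eq_zero.1 (cauchyDefect_eq_zero hq hs hx hy m n)
  rw [h2] at h
  rw [tsum_eq_sum (s := below m)]
  · exact h
  · intro k hk
    by_contra hne
    exact hk (mem_below.2 (increasing_whittakerRow q s y _ _
      (right_ne_zero_of_mul (left_ne_zero_of_mul hne))))

/-! ### Several variables -/

/-- The kernel of the lattice with the rows `x 0, …, x (n - 1)` from bottom to top. -/
def multiRow (q s : ℂ) : {n : ℕ} → (Fin n → ℂ) → (ℕ →₀ ℕ) → (ℕ →₀ ℕ) → ℂ
  | 0, _ => idKernel
  | _ + 1, x => kernelComp (whittakerRow q s (x 0)) (multiRow q s (Fin.tail x))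

theorem increasing_idKernel : Increasing idKernel := fun m l h => by
  have : m = l := by
    by_contra hne
    exact h (if_neg hne)
  subst this
  exact fun _ => le_rfl

theorem narrow_idKernel : Narrow idKernel := fun N => ⟨N, fun m l hm h => by
  have : m = l := by
    by_contra hne
    exact h (if_neg hne)
  rwa [← this]⟩

theorem tame_idKernel : Tame idKernel := by
  refine ⟨0, one_pos, fun r h0 _ N => ⟨1, fun m l _ => ?_⟩⟩
  rw [idKernel]
  split_ifs with h
  · rw [norm_one, h]
  · rw [norm_zero, zero_mul, one_mul]
    exact (pow_pos h0 _).le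

theorem increasing_multiRow (q s : ℂ) {n : ℕ} (x : Fin n → ℂ) : Increasing (multiRow q s x) := by
  induction n with
  | zero => exact increasing_idKernel
  | succ n ih => exact (increasing_whittakerRow q s (x 0)).comp (ih (Fin.tail x))

theorem narrow_multiRow (q s : ℂ) {n : ℕ} (x : Fin n → ℂ) : Narrow (multiRow q s x) := by
  induction n with
  | zero => exact narrow_idKernel
  | succ n ih => exact (narrow_whittakerRow q s (x 0)).comp (ih (Fin.tail x))

theorem tame_multiRow (hq : ‖q‖ < 1) (hs : ‖s‖ < 1) {n : ℕ} {x : Fin n → ℂ}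
    (hx : ∀ i, ‖x i‖ < 1) : Tame (multiRow q s x) := by
  induction n with
  | zero => exact tame_idKernel
  | succ n ih =>
    exact Tame.comp (increasing_whittakerRow q s (x 0)) (increasing_multiRow q s (Fin.tail x))
      (tame_whittakerRow hq hs (hx 0)) (ih fun i => hx i.succ)

/-- An identity for each of the rows `x i` gives one for the whole lattice. -/
theorem SkewCauchy.multiRow_left (hq : ‖q‖ < 1) (hs : ‖s‖ < 1)
    {B : (ℕ →₀ ℕ) → (ℕ →₀ ℕ) → ℂ} (hB : Increasing B) (hBn : Narrow B) (tB : Tame B) {n : ℕ}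
    {x : Fin n → ℂ} (hx : ∀ i, ‖x i‖ < 1) {C : Fin n → ℂ}
    (h : ∀ i, SkewCauchy (stateFactor q s) (whittakerRow q s (x i)) B (C i)) :
    SkewCauchy (stateFactor q s) (multiRow q s x) B (∏ i, C i) := by
  have hD := stateFactor_ne_zero (regular_of_norm_lt_one hq hs)
  induction n with
  | zero =>
    rw [Fin.prod_univ_zero]
    exact SkewCauchy.of_id hD B
  | succ n ih =>
    rw [Fin.prod_univ_succ]
    exact SkewCauchy.comp hD (norm_stateFactor_le hq hs) (increasing_multiRow q s _) hB hBn
      (tame_whittakerRow hq hs (hx 0)) (tame_multiRow hq hs fun i => hx i.succ) tB (h 0)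
      (ih (fun i => hx i.succ) fun i => h i.succ)

theorem skewCauchy_multiRow (hq : ‖q‖ < 1) (hs : ‖s‖ < 1) {m n : ℕ} {x : Fin m → ℂ}
    {y : Fin n → ℂ} (hx : ∀ i, ‖x i‖ < 1) (hy : ∀ j, ‖y j‖ < 1) :
    SkewCauchy (stateFactor q s) (multiRow q s x) (multiRow q s y)
      (∏ i, ∏ j, cauchyConst q s (x i) (y j)) := by
  refine SkewCauchy.multiRow_left hq hs (increasing_multiRow q s y) (narrow_multiRow q s y)
    (tame_multiRow hq hs hy) hx fun i => SkewCauchy.symm ?_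
  exact SkewCauchy.multiRow_left hq hs (increasing_whittakerRow q s _)
    (narrow_whittakerRow q s _) (tame_whittakerRow hq hs (hx i)) hy fun j =>
      (skewCauchy_whittakerRow hq hs (hx i) (hy j)).symm

/-! ### Partition functions -/

/-- The state of the horizontal edges of a row that is forced by the conservation of paths. -/
def horizontalState (b t : ℕ →₀ ℕ) : ℕ →₀ ℕ :=
  Finsupp.onFinset (Finset.range (exists_tailSum_eq_zero t).choose)
    (fun c => tailSum t c - tailSum b c) fun c hc => by
      rw [Finset.mem_range]
      by_contra hlt
      exact hc (by rw [(exists_tailSum_eq_zero t).choose_spec c (not_lt.1 hlt), Nat.zero_sub])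

theorem conserve_of_finprod_ne_zero {q s x : ℂ} {b h t : ℕ →₀ ℕ}
    (hne : ∏ᶠ c : ℕ, vertexWeight q s x (b c) (h c) (t c) (h (c + 1)) ≠ 0) (c : ℕ) :
    tailSum b c + h c = tailSum t c := by
  refine tailSum_conservation b h t (fun c => ?_) c
  by_contra hc
  exact hne (finprod_eq_zero _ c (if_neg fun hh => hc hh.1) (finite_mulSupport q s x b h t))

/-- The weight of a row with the forced horizontal state.  If no horizontal state conserves paths,
then both sides vanish. -/
theorem row_eq_whittakerRow (q s x : ℂ) (b t : ℕ →₀ ℕ) :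
    vertexWeightInf q s x (horizontalState b t 0) * ∏ᶠ c : ℕ, vertexWeight q s x (b c)
        (horizontalState b t c) (t c) (horizontalState b t (c + 1)) =
      qPochInf q (-s * x) / qPochInf q (s ^ 2) * whittakerRow q s x b t := by
  rw [whittakerRow, fullRow, rowWeight]
  split_ifs with h
  · simp only [horizontalState, Finsupp.onFinset_apply, vertexWeightInf, boundaryWeight]
    ring
  · rw [mul_zero, mul_zero, mul_eq_zero_of_right]
    by_contra hne
    have h1 := conserve_of_finprod_ne_zero hne 0
    rw [horizontalState, Finsupp.onFinset_apply] at h1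
    omega

/-- The product of the weights of the rows between the states `v 0, …, v n`. -/
def pathWeight (q s : ℂ) {n : ℕ} (x : Fin n → ℂ) (v : Fin (n + 1) → ℕ →₀ ℕ) : ℂ :=
  ∏ r : Fin n, whittakerRow q s (x r) (v r.castSucc) (v r.succ)

theorem configWeight_horizontalState (q s : ℂ) {n : ℕ} (x : Fin n → ℂ)
    (v : Fin (n + 1) → ℕ →₀ ℕ) :
    configWeight q s x v (fun r => horizontalState (v r.castSucc) (v r.succ)) =
      (∏ i, (qPochInf q (-s * x i) / qPochInf q (s ^ 2))) * pathWeight q s x v := by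
  rw [configWeight, pathWeight, ← Finset.prod_mul_distrib]
  exact Finset.prod_congr rfl fun r _ => row_eq_whittakerRow q s (x r) _ _

theorem eq_horizontalState {q s : ℂ} {n : ℕ} {x : Fin n → ℂ} {v : Fin (n + 1) → ℕ →₀ ℕ}
    {h : Fin n → ℕ →₀ ℕ} (hne : configWeight q s x v h ≠ 0) :
    h = fun r => horizontalState (v r.castSucc) (v r.succ) := by
  funext r
  ext c
  have h1 := conserve_of_finprod_ne_zero
    (right_ne_zero_of_mul (Finset.prod_ne_zero_iff.1 hne r (Finset.mem_univ r))) c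
  rw [horizontalState, Finsupp.onFinset_apply]
  omega

open Classical in
/-- The horizontal edges are summed out, as they are determined by the vertical ones. -/
theorem partitionFunction_eq_tsum (q s : ℂ) {n : ℕ} (x : Fin n → ℂ) (bot top : ℕ →₀ ℕ) :
    partitionFunction q s x bot top =
      (∏ i, (qPochInf q (-s * x i) / qPochInf q (s ^ 2))) *
        ∑' v : Fin (n + 1) → ℕ →₀ ℕ,
          if v 0 = bot ∧ v (Fin.last n) = top then pathWeight q s x v else 0 := by
  rw [partitionFunction, ← tsum_eq_finsum (L := SummationFilter.unconditional _), ← tsum_mul_left]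
  · have hinj : Function.Injective fun v : Fin (n + 1) → ℕ →₀ ℕ =>
        (v, fun r : Fin n => horizontalState (v r.castSucc) (v r.succ)) :=
      fun v v' h => congrArg Prod.fst h
    rw [← hinj.tsum_eq]
    · refine tsum_congr fun v => ?_
      rw [mul_ite, mul_zero, ← configWeight_horizontalState]
    · rintro ⟨v, h⟩ hp
      refine ⟨v, ?_⟩
      have h1 : configWeight q s x v h ≠ 0 := fun h0 => hp (by simp [h0])
      rw [eq_horizontalState h1]
  · refine (finite_support q s x top).subset fun p hp => ?_
    rw [Function.mem_support] at hp
    split_ifs at hp with h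
    · exact ⟨h.2, hp⟩
    · exact absurd rfl hp

theorem finite_support_pathWeight (q s : ℂ) {n : ℕ} (x : Fin n → ℂ) (top : ℕ →₀ ℕ) :
    {v : Fin (n + 1) → ℕ →₀ ℕ | v (Fin.last n) = top ∧ pathWeight q s x v ≠ 0}.Finite := by
  refine (Set.Finite.pi' (t := fun _ : Fin (n + 1) => {f | StateLE f top})
    fun _ => finite_setOf_stateLE top).subset ?_
  rintro v ⟨htop, hv⟩ r
  induction r using Fin.reverseInduction with
  | last => exact fun c => by rw [htop]
  | cast r ih =>
    exact (increasing_whittakerRow q s (x r) _ _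
      (Finset.prod_ne_zero_iff.1 hv r (Finset.mem_univ r))).trans ih

open Classical in
/-- The sum over all sequences of intermediate states is the iterated composition of kernels. -/
theorem tsum_pathWeight (q s : ℂ) {n : ℕ} (x : Fin n → ℂ) (bot top : ℕ →₀ ℕ) :
    ∑' v : Fin (n + 1) → ℕ →₀ ℕ,
      (if v 0 = bot ∧ v (Fin.last n) = top then pathWeight q s x v else 0) =
    multiRow q s x bot top := by
  induction n generalizing bot with
  | zero =>
    rw [tsum_eq_single (fun _ => bot), multiRow, idKernel]
    · simp [pathWeight]
    · intro v hv
      refine if_neg fun h => hv (funext fun i => ?_)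
      rw [Fin.fin_one_eq_zero i, h.1]
  | succ n ih =>
    have hi : Function.Injective fun w : Fin (n + 1) → ℕ →₀ ℕ =>
        (Fin.cons bot w : Fin (n + 2) → ℕ →₀ ℕ) := fun w w' h =>
      Fin.cons_right_injective (α := fun _ : Fin (n + 2) => ℕ →₀ ℕ) bot h
    have hj : Function.Injective fun w : Fin (n + 1) → ℕ →₀ ℕ => (w 0, w) :=
      fun w w' h => congrArg Prod.snd h
    let F : (ℕ →₀ ℕ) × (Fin (n + 1) → ℕ →₀ ℕ) → ℂ := fun p =>
      whittakerRow q s (x 0) bot p.1 * if p.2 0 = p.1 ∧ p.2 (Fin.last n) = top then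
        pathWeight q s (Fin.tail x) p.2 else 0
    have hF : ∀ p, F p ≠ 0 → p.2 0 = p.1 ∧ p.2 (Fin.last n) = top ∧
        pathWeight q s (Fin.tail x) p.2 ≠ 0 := by
      intro p hp
      have h := right_ne_zero_of_mul hp
      split_ifs at h with h1
      · exact ⟨h1.1, h1.2, h⟩
      · exact absurd rfl h
    have hsum : Summable F := by
      refine summable_of_hasFiniteSupport
        (((finite_support_pathWeight q s (Fin.tail x) top).image fun w => (w 0, w)).subset
          fun p hp => ?_)
      obtain ⟨h1, h2⟩ := hF p hp
      exact ⟨p.2, h2, Prod.ext h1 rfl⟩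
    -- The first state is fixed to be `bot`; the sum over the second one is carried out last.
    calc _ = ∑' w : Fin (n + 1) → ℕ →₀ ℕ, F (w 0, w) := by
          rw [← hi.tsum_eq]
          · refine tsum_congr fun w => ?_
            have e1 : (Fin.cons bot w : Fin (n + 2) → ℕ →₀ ℕ) (Fin.last (n + 1)) =
              w (Fin.last n) := rfl
            simp only [Fin.cons_zero, e1, true_and, F, mul_ite, mul_zero]
            rw [pathWeight, Fin.prod_univ_succ]
            rfl
          · intro v hv
            refine ⟨Fin.tail v, ?_⟩
            have h0 : v 0 = bot := by
              by_contra hne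
              exact hv (if_neg fun h => hne h.1)
            rw [← h0]
            exact Fin.cons_self_tail v
      _ = ∑' p, F p := by
          refine hj.tsum_eq fun p hp => ⟨p.2, Prod.ext (hF p hp).1 rfl⟩
      _ = ∑' r, ∑' w, F (r, w) := hsum.tsum_prod
      _ = _ := by
          rw [multiRow, kernelComp]
          refine tsum_congr fun r => ?_
          rw [← ih (Fin.tail x) r, ← tsum_mul_left]

/-! ### Young diagrams -/

theorem tailSum_conjState (lam : YoungDiagram) (c : ℕ) : tailSum (conjState lam) c = lam.rowLen c :=
  tailSum_unique _ _ (fun c => by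
    have := lam.rowLen_anti c (c + 1) (Nat.le_succ c)
    rw [conjState, Finsupp.onFinset_apply]
    omega) ⟨lam.colLen 0, fun _ hc => rowLen_eq_zero lam hc⟩ c

/-- The Young diagram whose row lengths are the tail sums of a state. -/
def diagram (f : ℕ →₀ ℕ) : YoungDiagram where
  cells := (Finset.range (exists_tailSum_eq_zero f).choose ×ˢ Finset.range (tailSum f 0)).filter
    fun p => p.2 < tailSum f p.1
  isLowerSet := by
    rintro ⟨i, j⟩ ⟨i', j'⟩ ⟨hi, hj⟩ h
    simp only [Finset.mem_coe, Finset.mem_filter, Finset.mem_product, Finset.mem_range] at h ⊢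
    dsimp only at hi hj
    have := tailSum_anti f hi
    omega

theorem mem_diagram {f : ℕ →₀ ℕ} {i j : ℕ} : (i, j) ∈ diagram f ↔ j < tailSum f i := by
  rw [← YoungDiagram.mem_cells, diagram, Finset.mem_filter, Finset.mem_product, Finset.mem_range,
    Finset.mem_range]
  have h1 := tailSum_anti f (Nat.zero_le i)
  have h2 := (exists_tailSum_eq_zero f).choose_spec i
  dsimp only
  omega

theorem rowLen_diagram (f : ℕ →₀ ℕ) (c : ℕ) : (diagram f).rowLen c = tailSum f c := by
  refine eq_of_forall_lt_iff fun j => ?_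
  rw [← YoungDiagram.mem_iff_lt_rowLen, mem_diagram]

theorem le_iff_stateLE {mu lam : YoungDiagram} :
    mu ≤ lam ↔ StateLE (conjState mu) (conjState lam) := by
  simp only [StateLE, tailSum_conjState]
  constructor
  · intro h c
    refine le_of_forall_lt fun j hj => ?_
    rw [← YoungDiagram.mem_iff_lt_rowLen] at hj ⊢
    exact h hj
  · rintro h ⟨i, j⟩ hij
    rw [YoungDiagram.mem_iff_lt_rowLen] at hij ⊢
    exact hij.trans_le (h i)

/-- Young diagrams correspond to states, through `conjState`. -/
def stateEquiv : YoungDiagram ≃ (ℕ →₀ ℕ) where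
  toFun := conjState
  invFun := diagram
  left_inv lam := by
    ext ⟨i, j⟩
    rw [YoungDiagram.mem_cells, YoungDiagram.mem_cells, mem_diagram, tailSum_conjState,
      YoungDiagram.mem_iff_lt_rowLen]
  right_inv f := eq_of_tailSum_eq fun c => by rw [tailSum_conjState, rowLen_diagram]

theorem dualFactor_eq (q s : ℂ) (lam : YoungDiagram) :
    dualFactor q s lam = stateFactor q s (conjState lam) := by
  rw [stateFactor_eq_prod q s (N := lam.colLen 0)]
  · rfl
  · rw [tailSum_conjState, rowLen_eq_zero lam le_rfl]

theorem spinWhittaker_eq {q s : ℂ} (hq : ‖q‖ < 1) (hs : ‖s‖ < 1) {n : ℕ} {x : Fin n → ℂ}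
    (hx : ∀ i, ‖x i‖ < 1) (lam mu : YoungDiagram) :
    spinWhittaker q s lam mu x = multiRow q s x (conjState mu) (conjState lam) := by
  have h : ∏ i, (qPochInf q (-s * x i) / qPochInf q (s ^ 2)) ≠ 0 :=
    Finset.prod_ne_zero_iff.2 fun i _ => div_ne_zero
      (qPochInf_ne_zero hq (norm_mul_lt_one (by rwa [norm_neg]) (hx i)))
      (qPochInf_ne_zero hq (norm_sq_lt_one hs))
  rw [spinWhittaker, partitionFunction_eq_tsum, tsum_pathWeight, mul_div_cancel_left₀ _ h]

end

end SpinQWhittaker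


theorem mainTheorem1 (q s : ℂ) (hq : ‖q‖ < 1) (hs : ‖s‖ < 1)
    (m n : ℕ) (hm : 0 < m) (hn : 0 < n)
    (x : Fin m → ℂ) (y : Fin n → ℂ) (hx : ∀ i, ‖x i‖ < 1) (hy : ∀ j, ‖y j‖ < 1)
    (mu nu : YoungDiagram) :
    HasSum
      (fun lam : {lam : YoungDiagram // mu ≤ lam ∧ nu ≤ lam} =>
        SpinQWhittaker.spinWhittaker q s lam.1 mu x *
          SpinQWhittaker.dualSpinWhittaker q s lam.1 nu y)
      ((∏ i : Fin m, ∏ j : Fin n,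
          SpinQWhittaker.qPochInf q (-s * x i) * SpinQWhittaker.qPochInf q (-s * y j) /
            (SpinQWhittaker.qPochInf q (s ^ 2) * SpinQWhittaker.qPochInf q (x i * y j))) *
        ∑ kap : {kap : YoungDiagram // kap ≤ mu ∧ kap ≤ nu},
          SpinQWhittaker.spinWhittaker q s nu kap.1 x *
            SpinQWhittaker.dualSpinWhittaker q s mu kap.1 y) := by
  open SpinQWhittaker in
  simp only [dualSpinWhittaker, spinWhittaker_eq hq hs hx, spinWhittaker_eq hq hs hy,
    dualFactor_eq]
  have hD := stateFactor_ne_zero (regular_of_norm_lt_one hq hs) (conjState nu)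
  -- Division by the factor of `nu` turns the symmetric form of the identity into the one with the
  -- dual polynomials.
  have h := stateEquiv.hasSum_iff.2
    ((skewCauchy_multiRow hq hs hx hy (conjState mu) (conjState nu)).div_const
      (stateFactor q s (conjState nu)))
  rw [← hasSum_subtype_iff_of_support_subset (s := {lam | mu ≤ lam ∧ nu ≤ lam})] at h
  · refine Eq.subst (motive := HasSum _) ?_ (h.congr_fun fun lam => ?_)
    rotate_left
    · simp only [Function.comp_apply, stateEquiv, Equiv.coe_fn_mk]
      ring
    · rw [← stateEquiv.tsum_eq, ← tsum_subtype_eq_of_support_subset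
        (s := {kap : YoungDiagram | kap ≤ mu ∧ kap ≤ nu}), mul_div_assoc, ← tsum_div_const,
        ← tsum_fintype (L := SummationFilter.unconditional _)]
      · refine congrArg₂ _ rfl (tsum_congr fun kap => ?_)
        simp only [stateEquiv, Equiv.coe_fn_mk]
        field_simp
      · intro kap hk
        exact ⟨le_iff_stateLE.2 (increasing_multiRow q s y _ _
            (right_ne_zero_of_mul (left_ne_zero_of_mul hk))),
          le_iff_stateLE.2 (increasing_multiRow q s x _ _
            (left_ne_zero_of_mul (left_ne_zero_of_mul hk)))⟩
  · intro lam hl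
    have hl' := left_ne_zero_of_mul (left_ne_zero_of_mul hl)
    exact ⟨le_iff_stateLE.2 (increasing_multiRow q s x _ _ (left_ne_zero_of_mul hl')),
      le_iff_stateLE.2 (increasing_multiRow q s y _ _ (right_ne_zero_of_mul hl'))⟩
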